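/- Let $m\ge 2$ be an integer, $a=\pi-\pi/m$, and $j\in\{1,2\}$. For complex-valued functions $p,q\in L_2(0,\pi)$ vanishing on $(0,a)$, let ${\cal B}_{1,j}(Q)$ denote the boundary value problem $$By'(x)+Q(x)y(x-a)=\lambda y(x),\quad 0<x<\pi,\qquad y_1(0)=y_j(\pi)=0,$$ $$B=\begin{bmatrix}0&1\\-1&0\end{bmatrix},\quad y=\begin{bmatrix}y_1\\y_2\end{bmatrix},\quad Q=\begin{bmatrix}q&p\\p&-q\end{bmatrix}.$$ Its eigenvalues are the zeros of its characteristic function $\Delta_j(\lambda)=y_j(\pi,\lambda)$, where $y(x,\lambda)$ is the solution of the equation with $y(0,\lambda)=(0,1)^T$. Let $\{\lambda_{n,j}\}_{n\in\mathbb Z}$ be the spectrum of ${\cal B}_{1,j}(Q)$, i.e. its eigenvalues, each repeated according to its multiplicity as a zero of $\Delta_j$, numbered so that $\lambda_{n,j}-n-\frac{1-j}2\to0$ as $|n|\to\infty$. For any such numbering, $\{\lambda_{mk,j}\}_{k\in\mathbb Z}$ is called an $m$-th subspectrum of ${\cal B}_{1,j}(Q)$. A complex sequence $\{\mu_{k,j}\}_{k\in\mathbb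 Z}$ is an $m$-th subspectrum of ${\cal B}_{1,j}(Q)$ for some such $p,q$ if and only if $$\mu_{k,j}=mk+\frac{1-j}2+\varkappa_{k,j},\quad k\in\mathbb Z,\qquad \{\varkappa_{k,j}\}_{k\in\mathbb Z}\in l_2.$$ -/

import Mathlib

open Filter Topology MeasureTheory Set
open scoped Matrix ENNReal

noncomputable section

namespace DelayDirac

/-- The matrix `B` of the Dirac system. -/
def B : Matrix (Fin 2) (Fin 2) ℂ := !![0, 1; -1, 0]

/-- The potential matrix `Q(x)` in the form `q₁₁ = -q₂₂ = q`, `q₁₂ = q₂₁ = p`. -/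
def Q (p q : ℝ → ℂ) (x : ℝ) : Matrix (Fin 2) (Fin 2) ℂ := !![q x, p x; p x, -q x]

/-- Admissible potentials for the delay `a`: complex-valued functions in `L₂(0, π)` that vanish
(almost everywhere) on `(0, a)`. -/
structure IsPotential (a : ℝ) (p q : ℝ → ℂ) : Prop where
  memLp_p : MemLp p 2 (volume.restrict (Ioo 0 Real.pi))
  memLp_q : MemLp q 2 (volume.restrict (Ioo 0 Real.pi))
  p_zero : ∀ᵐ x ∂(volume.restrict (Ioo 0 a)), p x = 0
  q_zero : ∀ᵐ x ∂(volume.restrict (Ioo 0 a)), q x = 0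

/-- `y` is a solution on `[0, π]` of `B y'(x) + Q(x) y(x - a) = z y(x)`, `0 < x < π`: it is
absolutely continuous on `[0, π]` and the equation holds almost everywhere. The values of `y` at
negative arguments play no role, because `Q` vanishes on `(0, a)`. -/
structure IsSolution (a : ℝ) (p q : ℝ → ℂ) (z : ℂ) (y : ℝ → Fin 2 → ℂ) : Prop where
  absCont : AbsolutelyContinuousOnInterval y 0 Real.pi
  equation : ∀ᵐ x ∂(volume.restrict (Ioo 0 Real.pi)), DifferentiableAt ℝ y x ∧
    B *ᵥ deriv y x + Q p q x *ᵥ y (x - a) = z • y x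

/-- `z` is an eigenvalue of the problem with the boundary conditions `y₁(0) = 0` and
`y_{j+1}(π) = 0`. Here `j : Fin 2` is the zero-based number of the component in the second
condition, and the components of `y` are `y 0 = y₁`, `y 1 = y₂`. -/
def IsEigenvalue (a : ℝ) (p q : ℝ → ℂ) (j : Fin 2) (z : ℂ) : Prop :=
  ∃ y : ℝ → Fin 2 → ℂ, IsSolution a p q z y ∧ y 0 0 = 0 ∧ y Real.pi j = 0 ∧
    ∃ x ∈ Icc 0 Real.pi, y x ≠ 0

/-- `Δ` is the characteristic function of the same problem: `Δ(z)` is the component `j` at `π` of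
the solution with the initial value `y(0) = (0, 1)`. -/
def IsCharFun (a : ℝ) (p q : ℝ → ℂ) (j : Fin 2) (Δ : ℂ → ℂ) : Prop :=
  ∀ z : ℂ, ∃ y : ℝ → Fin 2 → ℂ, IsSolution a p q z y ∧ y 0 = ![0, 1] ∧ Δ z = y Real.pi j

/-- `lam` numbers the spectrum of the problem by the integers: its values are exactly the
eigenvalues, each one repeated according to its multiplicity as a zero of the characteristic
function, and the numbering is the asymptotic one, `lam n - (n + (1 - (j + 1)) / 2) → 0` as
`|n| → ∞` (recall that `j` is zero-based). -/
structure IsSpectrum (a : ℝ) (p q : ℝ → ℂ) (j : Fin 2) (lam : ℤ → ℂ) : Prop where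
  eigenvalue : ∀ z : ℂ, z ∈ range lam ↔ IsEigenvalue a p q j z
  multiplicity : ∃ Δ : ℂ → ℂ, IsCharFun a p q j Δ ∧
    ∀ z : ℂ, {n : ℤ | lam n = z}.encard = analyticOrderAt Δ z
  numbering : Tendsto (fun n : ℤ => lam n - ((n : ℂ) + (1 - (((j : ℕ) : ℂ) + 1)) / 2))
    cofinite (𝓝 0)

/-- `μ` is an `m`-th subspectrum: `μ k = lam (m k)` for a numbering `lam` of the spectrum. -/
def IsSubspectrum (m : ℕ) (a : ℝ) (p q : ℝ → ℂ) (j : Fin 2) (μ : ℤ → ℂ) : Prop :=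
  ∃ lam : ℤ → ℂ, IsSpectrum a p q j lam ∧ ∀ k : ℤ, μ k = lam ((m : ℤ) * k)

end DelayDirac

end

noncomputable section

/-! ### The Paley–Wiener space and sampling at perturbed integers -/

namespace PaleyWiener

open Complex AddCircle

/-! The system decouples, up to the delay, in the combinations `y₂ ± i y₁`. Since `m ≥ 2` gives `π ≤
2a`, the delayed argument `x - a` stays below `a`, where the potential has not yet acted, so one
integration solves the equation (`comb_eq`, `isSolution_sol`). At `x = π` the characteristic
function is the free one, `-sin πz` or `cos πz`, plus integrals of `p ± iq` over `(a, π)` against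
exponentials `exp(izu)` with `|u| ≤ π/m`. Rescaling by `m` turns this perturbation into `G(z/m)`
with `G` in the space `PW` of transforms of `L₂(-π, π)` (`exists_charFun_eq`), and every such `G`
occurs (`exists_potential`). After the shift by `(1-j)/2` the question concerns the zeros of `Δ(s) =
c sin πs + G(s/m)`, `c = ±1`.

Necessity: `G(s/m)` is itself in `PW`, so its samples at boundedly perturbed integers are in `ℓ²`;
at a zero `n + ζ` with `ζ` small, `|ζ| ≤ |sin πζ| = |G((n+ζ)/m)| / |c|` (`memℓp_zeros`). This holds
for all zeros, hence for every `m`-th one.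

Sufficiency: with `s = mx`, `G` has to take the values `-c sin(πmx)` at `x = k + κ_k/m`, and these
form an `ℓ²` sequence. Sampling at nodes within `1/10` of the integers is an isomorphism of `PW`
onto `ℓ²` (`sampling_bijective`); the finitely many remaining nodes are moved into place one at a
time, with multiplicities (`Solvable.update`). It remains to number all zeros of `Δ` with the
prescribed ones at the multiples of `m`. The others lie near integers up to finitely many indices
(`exists_zeros_near_int`), the finite gap is filled by roots of polynomial quotients
(`exists_vanishesOn_univ`), and a completeness argument shows that no zero is left over
(`encard_eq_analyticOrderAt`). -/

instance fact_two_pi_pos : Fact (0 < 2 * Real.pi) := ⟨Real.two_pi_pos⟩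

/-- The circle of length `2π`. -/
abbrev Circ : Type := AddCircle (2 * Real.pi)

/-- The Hilbert space `L²` of the circle. -/
abbrev H : Type := Lp ℂ 2 (haarAddCircle : Measure Circ)

/-- The sequence space `ℓ²(ℤ)`. -/
abbrev ell2 : Type := lp (fun _ : ℤ => ℂ) 2

/-- The coordinate on the circle with values in `(-π, π]`. -/
def coord (t : Circ) : ℝ := (measurableEquivIoc (2 * Real.pi) (-Real.pi) t : ℝ)

lemma measurable_coord : Measurable coord :=
  measurable_subtype_coe.comp (measurableEquivIoc (2 * Real.pi) (-Real.pi)).measurable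

lemma coe_coord (t : Circ) : ((coord t : ℝ) : Circ) = t :=
  (equivIoc (2 * Real.pi) (-Real.pi)).symm_apply_apply t

lemma coord_coe {x : ℝ} (hx : x ∈ Ioc (-Real.pi) (-Real.pi + 2 * Real.pi)) :
    coord (x : Circ) = x := by
  have := equivIoc_coe_eq hx
  simp only [coord]
  exact congrArg Subtype.val this

lemma abs_coord_le (t : Circ) : |coord t| ≤ Real.pi := by
  have h := (measurableEquivIoc (2 * Real.pi) (-Real.pi) t).2
  rw [abs_le]
  constructor
  · exact h.1.le
  · have := h.2
    change coord t ≤ _ at this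
    linarith

/-- The exponential `e^{-izs}` in the coordinate `s` on the circle. -/
def expo (z : ℂ) (t : Circ) : ℂ := cexp (-(I * z * coord t))

lemma measurable_expo (z : ℂ) : Measurable (expo z) := by
  unfold expo
  have := measurable_coord
  fun_prop

lemma norm_expo_le (z : ℂ) (t : Circ) : ‖expo z t‖ ≤ Real.exp (Real.pi * ‖z‖) := by
  unfold expo
  refine (norm_exp_le_exp_norm _).trans (Real.exp_le_exp.2 ?_)
  rw [norm_neg, norm_mul, norm_mul, norm_I, one_mul, norm_real, Real.norm_eq_abs, mul_comm]
  exact mul_le_mul_of_nonneg_right (abs_coord_le t) (norm_nonneg _)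

lemma expo_add (z w : ℂ) (t : Circ) : expo (z + w) t = expo z t * expo w t := by
  unfold expo
  rw [← Complex.exp_add]
  ring_nf

lemma expo_intCast (k : ℤ) (t : Circ) : expo k t = fourier (-k) t := by
  conv_rhs => rw [← coe_coord t, fourier_coe_apply]
  unfold expo
  congr 1
  push_cast
  have : (Real.pi : ℂ) ≠ 0 := by exact_mod_cast Real.pi_ne_zero
  field_simp

lemma integrable_coe (f : H) : Integrable f (haarAddCircle : Measure Circ) :=
  (Lp.memLp f).integrable (by norm_num)

lemma integrable_mul_coe {g : Circ → ℂ} (hg : Measurable g) {C : ℝ} (hC : ∀ t, ‖g t‖ ≤ C) (f : H) :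
    Integrable (fun t => g t * f t) (haarAddCircle : Measure Circ) :=
  (integrable_coe f).bdd_mul hg.aestronglyMeasurable (Eventually.of_forall hC)

/-- The Fourier-Laplace transform of a function on the circle. -/
def transform : H →ₗ[ℂ] (ℂ → ℂ) where
  toFun f z := ∫ t, expo z t * f t ∂haarAddCircle
  map_add' f g := by
    ext z
    rw [Pi.add_apply, ← integral_add (integrable_mul_coe (measurable_expo z) (norm_expo_le z) f)
      (integrable_mul_coe (measurable_expo z) (norm_expo_le z) g)]
    refine integral_congr_ae ?_
    filter_upwards [Lp.coeFn_add f g] with t ht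
    rw [ht, Pi.add_apply, mul_add]
  map_smul' c f := by
    ext z
    rw [RingHom.id_apply, Pi.smul_apply, smul_eq_mul, ← integral_const_mul]
    refine integral_congr_ae ?_
    filter_upwards [Lp.coeFn_smul c f] with t ht
    rw [ht, Pi.smul_apply, smul_eq_mul]
    ring

lemma transform_apply (f : H) (z : ℂ) :
    transform f z = ∫ t, expo z t * f t ∂haarAddCircle := rfl

lemma transform_intCast (f : H) (k : ℤ) : transform f k = fourierBasis.repr f k := by
  rw [fourierBasis_repr, transform_apply, fourierCoeff]
  simp only [expo_intCast, smul_eq_mul]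

lemma memLp_bdd_mul {g : Circ → ℂ} (hg : Measurable g) {C : ℝ} (hC : ∀ t, ‖g t‖ ≤ C) (f : H) :
    MemLp (fun t => g t * f t) 2 (haarAddCircle : Measure Circ) :=
  (Lp.memLp f).of_le_mul (hg.aestronglyMeasurable.mul (Lp.memLp f).1)
    (Eventually.of_forall fun t => by
      rw [norm_mul]; exact mul_le_mul_of_nonneg_right (hC t) (norm_nonneg _))

/-- Multiplication by a bounded measurable function on `L²` of the circle. -/
def mulCLM (g : Circ → ℂ) (hg : Measurable g) (C : ℝ) (hC : ∀ t, ‖g t‖ ≤ C) : H →L[ℂ] H :=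
  LinearMap.mkContinuous
    { toFun := fun f => (memLp_bdd_mul hg hC f).toLp (fun t => g t * f t)
      map_add' := fun f₁ f₂ => by
        rw [← MemLp.toLp_add]
        refine MemLp.toLp_congr _ _ ?_
        filter_upwards [Lp.coeFn_add f₁ f₂] with t ht
        simp only [ht, Pi.add_apply, mul_add]
      map_smul' := fun c f => by
        rw [RingHom.id_apply, ← MemLp.toLp_const_smul]
        refine MemLp.toLp_congr _ _ ?_
        filter_upwards [Lp.coeFn_smul c f] with t ht
        simp only [ht, Pi.smul_apply, smul_eq_mul]
        ring } C (fun f => by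
      refine Lp.norm_le_mul_norm_of_ae_le_mul ?_
      filter_upwards [MemLp.coeFn_toLp (memLp_bdd_mul hg hC f)] with t ht
      simp only [LinearMap.coe_mk, AddHom.coe_mk]
      rw [ht, norm_mul]
      exact mul_le_mul_of_nonneg_right (hC t) (norm_nonneg _))

lemma coeFn_mulCLM {g : Circ → ℂ} (hg : Measurable g) {C : ℝ} (hC : ∀ t, ‖g t‖ ≤ C) (f : H) :
    mulCLM g hg C hC f =ᵐ[haarAddCircle] fun t => g t * f t :=
  MemLp.coeFn_toLp (memLp_bdd_mul hg hC f)

lemma norm_mulCLM_le {g : Circ → ℂ} (hg : Measurable g) {C : ℝ} (h0 : 0 ≤ C)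
    (hC : ∀ t, ‖g t‖ ≤ C) : ‖mulCLM g hg C hC‖ ≤ C :=
  LinearMap.mkContinuous_norm_le _ h0 _

/-- The space of Fourier-Laplace transforms of square-integrable functions on `(-π, π)`. -/
def PW : Submodule ℂ (ℂ → ℂ) := LinearMap.range transform

lemma transform_shift (f : H) (c : ℂ) : ∃ g : H, ∀ z, transform g z = transform f (z + c) := by
  refine ⟨mulCLM (expo c) (measurable_expo c) _ (norm_expo_le c) f, fun z => ?_⟩
  rw [transform_apply, transform_apply]
  refine integral_congr_ae ?_
  filter_upwards [coeFn_mulCLM (measurable_expo c) (norm_expo_le c) f] with t ht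
  rw [ht, expo_add, mul_assoc]

lemma PW.shift {W : ℂ → ℂ} (hW : W ∈ PW) (c : ℂ) : (fun z => W (z + c)) ∈ PW := by
  obtain ⟨f, rfl⟩ := hW
  obtain ⟨g, hg⟩ := transform_shift f c
  exact ⟨g, funext hg⟩

/-- The operator of multiplication by `-is`. -/
def derivCLM : H →L[ℂ] H :=
  mulCLM (fun t => -(I * coord t)) (by have := measurable_coord; fun_prop) Real.pi (fun t => by
    rw [norm_neg, norm_mul, norm_I, one_mul, norm_real]; exact abs_coord_le t)

lemma norm_derivCLM_le : ‖derivCLM‖ ≤ Real.pi := norm_mulCLM_le _ Real.pi_pos.le _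

lemma coeFn_derivCLM (f : H) :
    derivCLM f =ᵐ[haarAddCircle] fun t => -(I * coord t) * f t :=
  coeFn_mulCLM _ _ f

lemma coeFn_derivCLM_pow (p : ℕ) (f : H) :
    (derivCLM ^ p) f =ᵐ[haarAddCircle] fun t => (-(I * coord t)) ^ p * f t := by
  induction p with
  | zero => simp only [pow_zero, one_apply_eq_self, one_mul]; rfl
  | succ p ih =>
    rw [pow_succ', mul_apply_eq_comp]
    filter_upwards [ih, coeFn_derivCLM ((derivCLM ^ p) f)] with t h1 h2
    rw [h2, h1, pow_succ', mul_assoc]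

/-- Diagonal operator on `ℓ²`. -/
def diagCLM (κ : ℤ → ℂ) (δ : ℝ) (h0 : 0 ≤ δ) (hδ : ∀ k, ‖κ k‖ ≤ δ) : ell2 →L[ℂ] ell2 :=
  lp.mapCLM 2 (fun k => κ k • ContinuousLinearMap.id ℂ ℂ) h0 (fun k => by
    rw [norm_smul]
    exact (mul_le_of_le_one_right (norm_nonneg _) ContinuousLinearMap.norm_id_le).trans (hδ k))

lemma norm_diagCLM_le {κ : ℤ → ℂ} {δ : ℝ} (h0 : 0 ≤ δ) (hδ : ∀ k, ‖κ k‖ ≤ δ) :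
    ‖diagCLM κ δ h0 hδ‖ ≤ δ := lp.norm_mapCLM_le _ _ h0 _

lemma diagCLM_pow_apply {κ : ℤ → ℂ} {δ : ℝ} (h0 : 0 ≤ δ) (hδ : ∀ k, ‖κ k‖ ≤ δ) (p : ℕ) (a : ell2)
    (k : ℤ) : (diagCLM κ δ h0 hδ ^ p) a k = κ k ^ p * a k := by
  induction p with
  | zero => simp
  | succ p ih =>
    rw [pow_succ', mul_apply_eq_comp]
    have : ∀ b : ell2, diagCLM κ δ h0 hδ b k = κ k * b k := fun b => rfl
    rw [this, ih, pow_succ']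
    ring

/-- The isometry onto the Fourier coefficients, as a continuous linear map. -/
def coeffCLM : H →L[ℂ] ell2 :=
  (fourierBasis (T := 2 * Real.pi)).repr.toContinuousLinearEquiv.toContinuousLinearMap

lemma coeffCLM_apply (f : H) : coeffCLM f = fourierBasis.repr f := rfl

lemma norm_coeffCLM_le : ‖coeffCLM‖ ≤ 1 :=
  ContinuousLinearMap.opNorm_le_bound _ zero_le_one (fun f => by
    rw [coeffCLM_apply, LinearIsometryEquiv.norm_map, one_mul])

/-- The terms of the Taylor series of the sampling operator at perturbed integers. -/
def taylorTerm (κ : ℤ → ℂ) (δ : ℝ) (h0 : 0 ≤ δ) (hδ : ∀ k, ‖κ k‖ ≤ δ) (p : ℕ) : H →L[ℂ] ell2 :=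
  ((p.factorial : ℂ)⁻¹) • ((diagCLM κ δ h0 hδ ^ p) ∘L (coeffCLM ∘L (derivCLM ^ p)))

lemma norm_pow_le_of_norm_le {E : Type*} [NormedAddCommGroup E] [NormedSpace ℂ E]
    (A : E →L[ℂ] E) {C : ℝ} (hA : ‖A‖ ≤ C) (p : ℕ) : ‖A ^ p‖ ≤ C ^ p := by
  induction p with
  | zero =>
    rw [pow_zero, pow_zero]
    exact ContinuousLinearMap.norm_id_le
  | succ p ih =>
    rw [pow_succ, pow_succ]
    exact (norm_mul_le _ _).trans (mul_le_mul ih hA (norm_nonneg _) ((norm_nonneg _).trans ih))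

section sampling

variable {κ : ℤ → ℂ} {δ : ℝ}

lemma norm_taylorTerm_le (h0 : 0 ≤ δ) (hδ : ∀ k, ‖κ k‖ ≤ δ) (p : ℕ) :
    ‖taylorTerm κ δ h0 hδ p‖ ≤ (δ * Real.pi) ^ p / p.factorial := by
  unfold taylorTerm
  rw [norm_smul, norm_inv, Complex.norm_natCast, inv_mul_eq_div]
  refine div_le_div_of_nonneg_right ?_ (by positivity)
  refine (ContinuousLinearMap.opNorm_comp_le _ _).trans ?_
  rw [mul_pow]
  refine mul_le_mul (norm_pow_le_of_norm_le _ (norm_diagCLM_le h0 hδ) p) ?_ (norm_nonneg _)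
    (by positivity)
  refine (ContinuousLinearMap.opNorm_comp_le _ _).trans ?_
  rw [← one_mul (Real.pi ^ p)]
  exact mul_le_mul norm_coeffCLM_le (norm_pow_le_of_norm_le _ norm_derivCLM_le p) (norm_nonneg _)
    zero_le_one

variable (h0 : 0 ≤ δ) (hδ : ∀ k, ‖κ k‖ ≤ δ)

lemma summable_taylorTerm : Summable (taylorTerm κ δ h0 hδ) :=
  Summable.of_norm_bounded (Real.summable_pow_div_factorial _) (norm_taylorTerm_le h0 hδ)

/-- The sampling operator `W ↦ (W(k + κ k))`. -/
def sampling : H →L[ℂ] ell2 := ∑' p, taylorTerm κ δ h0 hδ p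

/-- This is the Taylor series of the transform at `k`: its `p`-th derivative there is the `k`-th
Fourier coefficient of `(-is)^p f`. Expanding `e^{-ics}` under the integral is justified by the
majorant `exp(π|c|) |f|`. -/
lemma hasSum_transform (f : H) (k : ℤ) (c : ℂ) :
    HasSum (fun p : ℕ => (p.factorial : ℂ)⁻¹ * (c ^ p * coeffCLM ((derivCLM ^ p) f) k))
      (transform f (k + c)) := by
  have key : ∀ p : ℕ, (p.factorial : ℂ)⁻¹ * (c ^ p * coeffCLM ((derivCLM ^ p) f) k) =
      ∫ t, (p.factorial : ℂ)⁻¹ * (c ^ p * (expo k t * ((-(I * coord t)) ^ p * f t)))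
        ∂haarAddCircle := by
    intro p
    rw [integral_const_mul, integral_const_mul, coeffCLM_apply, ← transform_intCast,
      transform_apply]
    congr 2
    refine integral_congr_ae ?_
    filter_upwards [coeFn_derivCLM_pow p f] with t ht
    rw [ht]
  simp only [key]
  rw [transform_apply]
  have hsum : ∀ t : Circ, HasSum (fun p : ℕ => (p.factorial : ℝ)⁻¹ * (‖c‖ * Real.pi) ^ p * ‖f t‖)
      (Real.exp (‖c‖ * Real.pi) * ‖f t‖) := by
    intro t
    refine HasSum.mul_right _ ?_
    have := NormedSpace.expSeries_div_hasSum_exp (‖c‖ * Real.pi)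
    rw [← Real.exp_eq_exp_ℝ] at this
    simpa only [div_eq_inv_mul] using this
  have hm := measurable_coord
  have hfm := (Lp.memLp f).1
  refine hasSum_integral_of_dominated_convergence
    (fun p t => (p.factorial : ℝ)⁻¹ * (‖c‖ * Real.pi) ^ p * ‖f t‖) (fun p => ?_) (fun p => ?_) ?_
    ?_ ?_
  · have h1 : Measurable fun t : Circ => expo k t * (-(I * coord t)) ^ p :=
      (measurable_expo k).mul (by fun_prop)
    have h2 := ((h1.aestronglyMeasurable (μ := haarAddCircle)).mul hfm).const_mul
      ((p.factorial : ℂ)⁻¹ * c ^ p)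
    refine h2.congr (Eventually.of_forall fun t => ?_)
    simp only [Pi.mul_apply]
    ring
  · refine Eventually.of_forall fun t => ?_
    rw [norm_mul, norm_mul, norm_mul, norm_mul, norm_inv, Complex.norm_natCast, norm_pow, norm_pow,
      norm_neg, norm_mul, norm_I, one_mul, norm_real, expo_intCast, mul_pow, ← mul_assoc, ← mul_assoc,
      ← mul_assoc]
    refine mul_le_mul_of_nonneg_right ?_ (norm_nonneg _)
    have h1 : ‖(fourier (-k) t : ℂ)‖ = 1 := Circle.norm_coe _
    rw [h1, mul_one, mul_assoc]
    refine mul_le_mul_of_nonneg_left ?_ (by positivity)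
    refine mul_le_mul_of_nonneg_left ?_ (by positivity)
    exact pow_le_pow_left₀ (norm_nonneg _) (abs_coord_le t) _
  · exact Eventually.of_forall fun t => (hsum t).summable
  · simp only [(hsum _).tsum_eq]
    exact ((integrable_coe f).norm).const_mul _
  · refine Eventually.of_forall fun t => ?_
    have h1 := NormedSpace.expSeries_div_hasSum_exp (-(I * c * coord t))
    rw [← Complex.exp_eq_exp_ℂ] at h1
    have h2 := (h1.mul_left (expo k t)).mul_right (f t)
    rw [expo_add]
    refine h2.congr_fun fun p => ?_
    rw [div_eq_inv_mul, show -(I * c * coord t) = c * (-(I * coord t)) by ring, mul_pow]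
    ring

lemma sampling_apply (f : H) (k : ℤ) : sampling h0 hδ f k = transform f (k + κ k) := by
  have h1 : HasSum (taylorTerm κ δ h0 hδ) (sampling h0 hδ) := (summable_taylorTerm h0 hδ).hasSum
  have h2 := (ContinuousLinearMap.apply ℂ ell2 f).hasSum h1
  have h3 := (lp.evalCLM ℂ (fun _ : ℤ => ℂ) 2 k).hasSum h2
  refine h3.unique ((hasSum_transform f k (κ k)).congr_fun fun p => ?_)
  change (taylorTerm κ δ h0 hδ p f : ell2) k = _
  rw [taylorTerm]
  change (p.factorial : ℂ)⁻¹ * ((diagCLM κ δ h0 hδ ^ p) (coeffCLM ((derivCLM ^ p) f))) k = _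
  rw [diagCLM_pow_apply]

/-- The term of order zero is the Fourier coefficient map; the others sum to at most `exp(δπ) - 1`.
The bound `1/10` is chosen so that `δπ ≤ 1/3` and `exp(1/3) ≤ 3/2`. -/
lemma norm_sampling_sub_le (hs : δ ≤ 1 / 10) : ‖sampling h0 hδ - coeffCLM‖ ≤ 1 / 2 := by
  have h1 : HasSum (taylorTerm κ δ h0 hδ) (sampling h0 hδ) := (summable_taylorTerm h0 hδ).hasSum
  have h2 : taylorTerm κ δ h0 hδ 0 = coeffCLM := by
    ext f k
    simp [taylorTerm]
  have h3 := (hasSum_nat_add_iff' 1).2 h1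
  rw [Finset.sum_range_one, h2] at h3
  have h4 : HasSum (fun p : ℕ => (δ * Real.pi) ^ p / p.factorial) (Real.exp (δ * Real.pi)) := by
    have := NormedSpace.expSeries_div_hasSum_exp (δ * Real.pi)
    rwa [← Real.exp_eq_exp_ℝ] at this
  have h5 := (hasSum_nat_add_iff' 1).2 h4
  rw [Finset.sum_range_one, pow_zero, Nat.factorial_zero, Nat.cast_one, div_one] at h5
  rw [← h3.tsum_eq]
  refine (tsum_of_norm_bounded h5 (fun p => norm_taylorTerm_le h0 hδ (p + 1))).trans ?_
  have h6 : δ * Real.pi ≤ 1 / 3 := by nlinarith [Real.pi_lt_d2, Real.pi_pos]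
  have h7 : Real.exp (1 / 3) ≤ 3 / 2 := by
    have := Real.exp_bound_div_one_sub_of_interval (x := 1 / 3) (by norm_num) (by norm_num)
    norm_num at this ⊢
    linarith
  have := Real.exp_le_exp.2 h6
  linarith

/-- Stability of bases: the sampling operator is the Fourier isometry composed with `1 - S`, `‖S‖ ≤
1/2`, which is invertible by the Neumann series. -/
lemma sampling_bijective (hs : δ ≤ 1 / 10) : Function.Bijective (sampling h0 hδ) := by
  let e := (fourierBasis (T := 2 * Real.pi)).repr
  let S : H →L[ℂ] H := e.symm.toContinuousLinearEquiv.toContinuousLinearMap ∘L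
    (coeffCLM - sampling h0 hδ)
  have hS : ‖S‖ < 1 := by
    have h1 : ‖S‖ ≤ 1 / 2 := by
      refine ContinuousLinearMap.opNorm_le_bound _ (by norm_num) fun f => ?_
      change ‖e.symm ((coeffCLM - sampling h0 hδ) f)‖ ≤ _
      rw [LinearIsometryEquiv.norm_map]
      refine (ContinuousLinearMap.le_opNorm _ f).trans
        (mul_le_mul_of_nonneg_right ?_ (norm_nonneg _))
      rw [norm_sub_rev]
      exact norm_sampling_sub_le h0 hδ hs
    linarith
  have hu : IsUnit (1 - S) := isUnit_one_sub_of_norm_lt_one hS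
  have hb : Function.Bijective (1 - S : H →L[ℂ] H) := by
    obtain ⟨u, hu⟩ := hu
    rw [← hu]
    refine Function.bijective_iff_has_inverse.2 ⟨(↑u⁻¹ : H →L[ℂ] H), fun f => ?_, fun f => ?_⟩
    · rw [← mul_apply_eq_comp, Units.inv_mul, one_apply_eq_self]
    · rw [← mul_apply_eq_comp, Units.mul_inv, one_apply_eq_self]
  have hfac : (sampling h0 hδ : H → ell2) = e ∘ (1 - S : H →L[ℂ] H) := by
    funext f
    change _ = e (f - e.symm (e f - sampling h0 hδ f))
    rw [map_sub, LinearIsometryEquiv.apply_symm_apply, sub_sub_cancel]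
  rw [hfac]
  exact e.bijective.comp hb

end sampling

/-- Samples at a bounded perturbation of the integers are square-summable. -/
lemma PW.memℓp_samples {W : ℂ → ℂ} (hW : W ∈ PW) {κ : ℤ → ℂ} {δ : ℝ} (hδ : ∀ k, ‖κ k‖ ≤ δ) :
    Memℓp (fun k : ℤ => W (k + κ k)) 2 := by
  obtain ⟨f, rfl⟩ := hW
  have h0 : 0 ≤ δ := (norm_nonneg _).trans (hδ 0)
  have := lp.memℓp (sampling h0 hδ f)
  convert this using 2 with k
  exact (sampling_apply h0 hδ f k).symm

/-- Interpolation at a small perturbation of the integers. -/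
lemma PW.exists_samples {κ : ℤ → ℂ} (hδ : ∀ k, ‖κ k‖ ≤ 1 / 10) {d : ℤ → ℂ} (hd : Memℓp d 2) :
    ∃ W ∈ PW, ∀ k : ℤ, W (k + κ k) = d k := by
  have h0 : (0 : ℝ) ≤ 1 / 10 := by norm_num
  obtain ⟨f, hf⟩ := (sampling_bijective h0 hδ le_rfl).2 ⟨d, hd⟩
  refine ⟨transform f, ⟨f, rfl⟩, fun k => ?_⟩
  rw [← sampling_apply h0 hδ, hf]

lemma PW.eq_zero_of_samples {κ : ℤ → ℂ} (hδ : ∀ k, ‖κ k‖ ≤ 1 / 10) {W : ℂ → ℂ} (hW : W ∈ PW)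
    (h : ∀ k : ℤ, W (k + κ k) = 0) : W = 0 := by
  have h0 : (0 : ℝ) ≤ 1 / 10 := by norm_num
  obtain ⟨f, rfl⟩ := hW
  have : f = 0 := by
    refine (sampling_bijective h0 hδ le_rfl).1 ?_
    rw [map_zero]
    ext k
    rw [sampling_apply h0 hδ, h]
    rfl
  rw [this, map_zero]

end PaleyWiener

/-! ### Absolutely continuous complex-valued functions -/

section absolutelyContinuous

lemma AbsolutelyContinuousOnInterval.ofReal {f : ℝ → ℝ} {a b : ℝ}
    (hf : AbsolutelyContinuousOnInterval f a b) :
    AbsolutelyContinuousOnInterval (fun x => (f x : ℂ)) a b := by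
  simpa only [AbsolutelyContinuousOnInterval, Complex.dist_of_im_eq, Complex.isometry_ofReal.dist_eq]
    using hf

lemma AbsolutelyContinuousOnInterval.congr_eqOn {E : Type*} [PseudoMetricSpace E] {f g : ℝ → E}
    {a b : ℝ} (hf : AbsolutelyContinuousOnInterval f a b) (h : EqOn f g (uIcc a b)) :
    AbsolutelyContinuousOnInterval g a b := by
  rw [absolutelyContinuousOnInterval_iff] at hf ⊢
  intro ε hε
  obtain ⟨δ, hδ, H⟩ := hf ε hε
  refine ⟨δ, hδ, fun P hP hs => ?_⟩
  refine lt_of_eq_of_lt (Finset.sum_congr rfl fun i hi => ?_) (H P hP hs)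
  rw [h (hP.1 i hi).1, h (hP.1 i hi).2]

lemma IntervalIntegrable.absolutelyContinuousOnInterval_complex {f : ℝ → ℂ} {a b : ℝ}
    (h : IntervalIntegrable f volume a b) :
    AbsolutelyContinuousOnInterval (fun x => ∫ v in a..x, f v) a b := by
  have hre : IntervalIntegrable (fun x => (f x).re) volume a b := ⟨h.1.re, h.2.re⟩
  have him : IntervalIntegrable (fun x => (f x).im) volume a b := ⟨h.1.im, h.2.im⟩
  have h1 := (hre.absolutelyContinuousOnInterval_intervalIntegral (left_mem_uIcc (b := b))).ofReal
  have h2 := ((him.absolutelyContinuousOnInterval_intervalIntegral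
    (left_mem_uIcc (b := b))).ofReal).const_smul Complex.I
  have h3 : EqOn (fun x => ((∫ v in a..x, (f v).re : ℝ) : ℂ) +
      Complex.I • ((∫ v in a..x, (f v).im : ℝ) : ℂ)) (fun x => ∫ v in a..x, f v) (uIcc a b) := by
    intro x hx
    have hsub : uIcc a x ⊆ uIcc a b := uIcc_subset_uIcc_left hx
    have hre' := hre.mono_set hsub
    have him' := him.mono_set hsub
    have hre'' : IntervalIntegrable (fun v => ((f v).re : ℂ)) volume a x :=
      ⟨hre'.1.ofReal, hre'.2.ofReal⟩
    have him'' : IntervalIntegrable (fun v => ((f v).im : ℂ)) volume a x :=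
      ⟨him'.1.ofReal, him'.2.ofReal⟩
    simp only
    rw [← intervalIntegral.integral_ofReal, ← intervalIntegral.integral_ofReal, smul_eq_mul,
      ← intervalIntegral.integral_const_mul, ← intervalIntegral.integral_add hre''
      (him''.const_mul _)]
    refine intervalIntegral.integral_congr fun v _ => ?_
    rw [mul_comm, Complex.re_add_im]
  exact (h1.add h2).congr_eqOn h3

lemma AbsolutelyContinuousOnInterval.sub_eq_integral {f g : ℝ → ℂ} {a b : ℝ}
    (hf : AbsolutelyContinuousOnInterval f a b) (hg : IntervalIntegrable g volume a b)
    (h : ∀ᵐ x, x ∈ uIcc a b → HasDerivAt f (g x) x) {x : ℝ} (hx : x ∈ uIcc a b) :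
    f x - f a = ∫ v in a..x, g v := by
  have h1 := hf.sub hg.absolutelyContinuousOnInterval_complex
  obtain ⟨C, hC⟩ := h1.const_of_ae_hasDerivAt_zero (by
    filter_upwards [h, hg.ae_hasDerivAt_integral] with y h2 h3 hy
    simpa using! (h2 hy).sub (h3 hy a left_mem_uIcc))
  have ha := hC a left_mem_uIcc
  have hb := hC x hx
  simp only [Pi.sub_apply, intervalIntegral.integral_same, sub_zero] at ha hb
  rw [ha, ← hb]
  ring

end absolutelyContinuous

/-! ### Paley–Wiener functions as integrals over `(-π, π)`, and division by a zero -/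

namespace PaleyWiener

open Complex AddCircle

lemma mem_PW_of_memLp {w : ℝ → ℂ} (hw : MemLp w 2 (volume.restrict (Ioc (-Real.pi) Real.pi))) :
    (fun z : ℂ => ∫ x in (-Real.pi)..Real.pi, w x * cexp (-(I * z * x))) ∈ PW := by
  have hpi : -Real.pi + 2 * Real.pi = Real.pi := by ring
  -- The Haar measure of the circle is normalised to mass one, hence the factor `2π`.
  have hw1 : MemLp ((2 * Real.pi : ℝ) • w) 2
      (volume.restrict (Ioc (-Real.pi) (-Real.pi + 2 * Real.pi))) := by
    rw [hpi]
    exact hw.const_smul _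
  have h := hw1.memLp_liftIoc.haarAddCircle
  refine ⟨h.toLp, funext fun z => ?_⟩
  rw [transform_apply]
  have h1 : ∫ t, expo z t * (h.toLp _ : H) t ∂haarAddCircle = ∫ t, liftIoc (2 * Real.pi) (-Real.pi)
      (fun x => cexp (-(I * z * x)) * ((2 * Real.pi : ℝ) • w) x) t ∂haarAddCircle := by
    refine integral_congr_ae ?_
    filter_upwards [h.coeFn_toLp] with t ht
    rw [ht]
    rfl
  rw [h1, integral_haarAddCircle, integral_liftIoc_eq_intervalIntegral, hpi,
    ← intervalIntegral.integral_smul]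
  refine intervalIntegral.integral_congr fun x _ => ?_
  have : (Real.pi : ℂ) ≠ 0 := by exact_mod_cast Real.pi_ne_zero
  simp only [Pi.smul_apply, real_smul]
  push_cast
  field_simp

lemma PW.exists_memLp {W : ℂ → ℂ} (hW : W ∈ PW) :
    ∃ w : ℝ → ℂ, MemLp w 2 (volume.restrict (Ioc (-Real.pi) Real.pi)) ∧
      ∀ z : ℂ, W z = ∫ x in (-Real.pi)..Real.pi, w x * cexp (-(I * z * x)) := by
  obtain ⟨f, rfl⟩ := hW
  have hpi : -Real.pi + 2 * Real.pi = Real.pi := by ring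
  have h := memLp_haarAddCircle_iff.1 (Lp.memLp f)
  have h1 := h.comp_measurePreserving (AddCircle.measurePreserving_mk (2 * Real.pi) (-Real.pi))
  rw [hpi] at h1
  refine ⟨fun x => (2 * Real.pi : ℂ)⁻¹ * f (x : Circ), h1.const_mul _, fun z => ?_⟩
  rw [transform_apply, integral_haarAddCircle, ← AddCircle.intervalIntegral_preimage _ (-Real.pi),
    hpi, ← intervalIntegral.integral_smul]
  refine intervalIntegral.integral_congr_ae (Eventually.of_forall fun x hx => ?_)
  rw [uIoc_of_le (by linarith [Real.pi_pos])] at hx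
  simp only [expo]
  rw [coord_coe (by rwa [hpi]), real_smul]
  push_cast
  ring

lemma PW.differentiable {W : ℂ → ℂ} (hW : W ∈ PW) : Differentiable ℂ W := by
  obtain ⟨f, rfl⟩ := hW
  intro z
  have hm := measurable_coord
  have hF' : Measurable fun t : Circ => -(I * coord t) * expo z t :=
    Measurable.mul (by fun_prop) (measurable_expo z)
  refine (hasDerivAt_integral_of_dominated_loc_of_deriv_le (μ := haarAddCircle)
    (F := fun z t => expo z t * f t) (F' := fun z t => -(I * coord t) * expo z t * f t)
    (bound := fun t => Real.pi * Real.exp (Real.pi * (‖z‖ + 1)) * ‖f t‖)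
    (Metric.ball_mem_nhds z one_pos) (Eventually.of_forall fun y =>
      (integrable_mul_coe (measurable_expo y) (norm_expo_le y) f).1)
    (integrable_mul_coe (measurable_expo z) (norm_expo_le z) f)
    (hF'.aestronglyMeasurable.mul (Lp.memLp f).1)
    (Eventually.of_forall fun t y hy => ?_) ((integrable_coe f).norm.const_mul _)
    (Eventually.of_forall fun t y _ => ?_)).2.differentiableAt
  · rw [norm_mul, norm_mul, norm_neg, norm_mul, norm_I, one_mul, norm_real]
    refine mul_le_mul_of_nonneg_right (mul_le_mul (abs_coord_le t) ((norm_expo_le y t).trans ?_)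
      (norm_nonneg _) Real.pi_pos.le) (norm_nonneg _)
    refine Real.exp_le_exp.2 (mul_le_mul_of_nonneg_left ?_ Real.pi_pos.le)
    rw [Metric.mem_ball, dist_eq_norm] at hy
    have := norm_add_le z (y - z)
    rw [add_sub_cancel] at this
    linarith
  · refine HasDerivAt.mul_const ?_ _
    unfold expo
    have h1 : HasDerivAt (fun y : ℂ => -(I * y * coord t)) (-(I * coord t)) y := by
      simpa using! (((hasDerivAt_id y).const_mul I).mul_const (coord t : ℂ)).neg
    simpa [mul_comm] using h1.cexp

lemma PW.analyticAt {W : ℂ → ℂ} (hW : W ∈ PW) (z : ℂ) : AnalyticAt ℂ W z :=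
  (PW.differentiable hW).analyticAt z

/-- Dividing out a zero does not lead out of the Paley-Wiener space. -/
lemma PW.exists_div {W : ℂ → ℂ} (hW : W ∈ PW) {z : ℂ} (hz : W z = 0) :
    ∃ G ∈ PW, ∀ s, W s = (s - z) * G s := by
  obtain ⟨w, hw, hWw⟩ := PW.exists_memLp hW
  have hle : -Real.pi ≤ Real.pi := by linarith [Real.pi_pos]
  have hwi : IntervalIntegrable w volume (-Real.pi) Real.pi := by
    rw [intervalIntegrable_iff_integrableOn_Ioc_of_le hle]
    exact hw.integrable (by norm_num)
  have hgi : ∀ s : ℂ, IntervalIntegrable (fun x => w x * cexp (-(I * s * x))) volume (-Real.pi)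
      Real.pi := fun s => hwi.mul_continuousOn (by fun_prop)
  -- The quotient is the transform of `i F(x) e^{izx}`. Integrating by parts gives back `W`: the
  -- boundary terms vanish because `F` is zero at `-π` by definition and at `π` because `W z = 0`.
  let F : ℝ → ℂ := fun x => ∫ v in (-Real.pi)..x, w v * cexp (-(I * z * v))
  have hFac : AbsolutelyContinuousOnInterval F (-Real.pi) Real.pi :=
    (hgi z).absolutelyContinuousOnInterval_complex
  have hFc : ContinuousOn F (Icc (-Real.pi) Real.pi) := by
    have := hFac.continuousOn
    rwa [uIcc_of_le hle] at this
  have hF0 : F (-Real.pi) = 0 := intervalIntegral.integral_same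
  have hF1 : F Real.pi = 0 := by rw [← hz, hWw]
  have hcont : ContinuousOn (fun x : ℝ => I * F x * cexp (I * z * x)) (Icc (-Real.pi) Real.pi) :=
    (continuousOn_const.mul hFc).mul (by fun_prop)
  have hmem : MemLp (fun x : ℝ => I * F x * cexp (I * z * x)) 2
      (volume.restrict (Ioc (-Real.pi) Real.pi)) := by
    obtain ⟨C, hC⟩ := isCompact_Icc.exists_bound_of_continuousOn hcont
    refine MemLp.of_bound ((hcont.mono Ioc_subset_Icc_self).aestronglyMeasurable measurableSet_Ioc)
      C ?_
    exact (ae_restrict_iff' measurableSet_Ioc).2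
      (Eventually.of_forall fun x hx => hC x (Ioc_subset_Icc_self hx))
  refine ⟨_, mem_PW_of_memLp hmem, fun s => ?_⟩
  have hE : ∀ x : ℝ, HasDerivAt (fun x : ℝ => cexp (-(I * (s - z) * x)))
      (cexp (-(I * (s - z) * x)) * (-(I * (s - z)))) x := by
    intro x
    have h1 : HasDerivAt (fun y : ℂ => -(I * (s - z) * y)) (-(I * (s - z))) (x : ℂ) := by
      simpa using! ((hasDerivAt_id (x : ℂ)).const_mul (I * (s - z))).neg
    exact h1.comp_ofReal.cexp
  have hEac : AbsolutelyContinuousOnInterval (fun x : ℝ => cexp (-(I * (s - z) * x)))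
      (-Real.pi) Real.pi := by
    refine ContDiffOn.absolutelyContinuousOnInterval (ContDiff.contDiffOn ?_)
    have : ContDiff ℝ 1 fun x : ℝ => (x : ℂ) := ofRealCLM.contDiff
    exact ((contDiff_const.mul this).neg).cexp
  have hprod := hFac.smul hEac
  have hd1 : IntervalIntegrable (fun x : ℝ => w x * cexp (-(I * s * x))) volume (-Real.pi) Real.pi :=
    hgi s
  have hd2 : IntervalIntegrable (fun x : ℝ => (s - z) *
      (I * F x * cexp (I * z * x) * cexp (-(I * s * x)))) volume (-Real.pi) Real.pi := by
    refine ContinuousOn.intervalIntegrable ?_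
    rw [uIcc_of_le hle]
    exact continuousOn_const.mul (hcont.mul (by fun_prop))
  have hsub := hprod.sub_eq_integral (hd1.sub hd2) (by
    filter_upwards [(hgi z).ae_hasDerivAt_integral] with x h3 hx
    have h4 := (h3 hx (-Real.pi) left_mem_uIcc).mul (hE x)
    refine HasDerivAt.congr_deriv (f := F • fun x : ℝ => cexp (-(I * (s - z) * x))) h4 ?_
    have e1 : cexp (-(I * s * x)) = cexp (-(I * z * x)) * cexp (-(I * (s - z) * x)) := by
      rw [← Complex.exp_add]; ring_nf
    have e2 : cexp (I * z * x) * cexp (-(I * s * x)) = cexp (-(I * (s - z) * x)) := by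
      rw [← Complex.exp_add]; ring_nf
    rw [mul_assoc (I * F x), e2, e1]
    simp only [F]
    ring) right_mem_uIcc
  rw [Pi.smul_apply', Pi.smul_apply', hF0, hF1, zero_smul, zero_smul, sub_zero] at hsub
  rw [intervalIntegral.integral_sub hd1 hd2, intervalIntegral.integral_const_mul] at hsub
  rw [hWw s]
  exact sub_eq_zero.1 hsub.symm

/-! ### Zeros with multiplicity: completeness, generators and moving finitely many nodes -/

open Function

/-- `f` vanishes at the nodes `ν k`, `k ∈ I`, with multiplicities. -/
def VanishesOn (f : ℂ → ℂ) (ν : ℤ → ℂ) (I : Set ℤ) : Prop :=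
  ∀ z, {k | k ∈ I ∧ ν k = z}.encard ≤ analyticOrderAt f z

lemma eq_of_sub_mul_eq {f g : ℂ → ℂ} (hf : Continuous f) (hg : Continuous g) (c : ℂ)
    (h : ∀ s, (s - c) * f s = (s - c) * g s) : f = g :=
  hf.ext_on (dense_compl_singleton c) hg fun s hs => mul_left_cancel₀ (sub_ne_zero.2 hs) (h s)

lemma analyticOrderAt_sub_mul {f : ℂ → ℂ} (hf : Differentiable ℂ f) (c z : ℂ) :
    analyticOrderAt (fun s => (s - c) * f s) z = (if c = z then 1 else 0) + analyticOrderAt f z := by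
  have h1 : AnalyticAt ℂ (fun s : ℂ => s - c) z := by fun_prop
  have h2 := analyticOrderAt_mul h1 (hf.analyticAt z)
  change analyticOrderAt ((fun s : ℂ => s - c) * f) z = _
  rw [h2]
  congr 1
  split_ifs with h
  · subst h
    exact analyticOrderAt_id_sub_const_self
  · exact analyticOrderAt_id_sub_const_of_ne (Ne.symm h)

lemma encard_insert_fiber {ν : ℤ → ℂ} {I : Set ℤ} {k : ℤ} (hk : k ∉ I) (z : ℂ) :
    {l | l ∈ insert k I ∧ ν l = z}.encard =
      (if ν k = z then 1 else 0) + {l | l ∈ I ∧ ν l = z}.encard := by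
  split_ifs with h
  · have : {l | l ∈ insert k I ∧ ν l = z} = insert k {l | l ∈ I ∧ ν l = z} := by
      ext l
      simp only [mem_insert_iff, mem_ofPred_eq]
      constructor
      · rintro ⟨rfl | hl, h2⟩
        · exact Or.inl rfl
        · exact Or.inr ⟨hl, h2⟩
      · rintro (rfl | ⟨hl, h2⟩)
        · exact ⟨Or.inl rfl, h⟩
        · exact ⟨Or.inr hl, h2⟩
    rw [this, encard_insert_of_notMem (fun h => hk h.1), add_comm]
  · rw [zero_add]
    congr 1
    ext l
    simp only [mem_insert_iff, mem_ofPred_eq]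
    constructor
    · rintro ⟨rfl | hl, h2⟩
      · exact absurd h2 h
      · exact ⟨hl, h2⟩
    · exact fun hl => ⟨Or.inr hl.1, hl.2⟩

namespace VanishesOn

variable {f g : ℂ → ℂ} {ν ν' : ℤ → ℂ} {I J : Set ℤ} {k : ℤ}

lemma mono (h : VanishesOn f ν J) (hIJ : I ⊆ J) : VanishesOn f ν I := fun z =>
  (encard_le_encard (t := {k | k ∈ J ∧ ν k = z}) fun _ hl => ⟨hIJ hl.1, hl.2⟩).trans (h z)

lemma congr_nodes (h : VanishesOn f ν I) (hν : EqOn ν ν' I) : VanishesOn f ν' I := fun z =>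
  (encard_le_encard (t := {k | k ∈ I ∧ ν k = z}) fun _ hl =>
    ⟨hl.1, (hν hl.1).trans hl.2⟩).trans (h z)

lemma apply_eq_zero (h : VanishesOn f ν I) (hk : k ∈ I) : f (ν k) = 0 := by
  refine apply_eq_zero_of_analyticOrderAt_ne_zero fun h0 => ?_
  have := h (ν k)
  rw [h0, nonpos_iff_eq_zero, encard_eq_zero] at this
  exact (this ▸ (⟨hk, rfl⟩ : k ∈ {l | l ∈ I ∧ ν l = ν k}) : k ∈ (∅ : Set ℤ))

lemma add (hf : VanishesOn f ν I) (hg : VanishesOn g ν I) : VanishesOn (f + g) ν I := fun z =>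
  (le_min (hf z) (hg z)).trans le_analyticOrderAt_add

lemma mul_right (hf : VanishesOn f ν I) (hf' : Differentiable ℂ f) (hg : Differentiable ℂ g) :
    VanishesOn (f * g) ν I := fun z => by
  rw [analyticOrderAt_mul (hf'.analyticAt z) (hg.analyticAt z)]
  exact (hf z).trans le_self_add

lemma const_smul (hf : VanishesOn f ν I) (hf' : Differentiable ℂ f) (c : ℂ) :
    VanishesOn (c • f) ν I := by
  have := hf.mul_right hf' (differentiable_const c)
  convert this using 1
  ext s
  simp [mul_comm]

/-- Both the number of nodes and the order of the function increase by one at `ν k` and are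
unchanged elsewhere. This is what allows nodes to be exchanged without assuming them distinct. -/
lemma sub_mul_iff (hf : Differentiable ℂ f) (hk : k ∉ I) :
    VanishesOn (fun s => (s - ν k) * f s) ν (insert k I) ↔ VanishesOn f ν I := by
  refine forall_congr' fun z => ?_
  rw [encard_insert_fiber hk, analyticOrderAt_sub_mul hf]
  refine ENat.add_le_add_iff_left ?_
  split_ifs <;> simp

lemma insert_of_le (h : VanishesOn f ν I) (hk : k ∉ I)
    (hle : {l | l ∈ I ∧ ν l = ν k}.encard + 1 ≤ analyticOrderAt f (ν k)) :
    VanishesOn f ν (insert k I) := fun z => by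
  rw [encard_insert_fiber hk]
  split_ifs with hz
  · subst hz
    rwa [add_comm]
  · rw [zero_add]
    exact h z

lemma of_injOn (hν : InjOn ν I) (hf : Differentiable ℂ f) (h : ∀ k ∈ I, f (ν k) = 0) :
    VanishesOn f ν I := fun z => by
  rcases eq_empty_or_nonempty {k | k ∈ I ∧ ν k = z} with h0 | ⟨k, hk⟩
  · rw [h0, encard_empty]
    exact zero_le
  · refine le_trans (encard_le_one_iff.2 fun a b ha hb => hν ha.1 hb.1 (ha.2.trans hb.2.symm)) ?_
    rw [Order.one_le_iff_ne_zero, (hf.analyticAt z).analyticOrderAt_ne_zero, ← hk.2]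
    exact h k hk.1

end VanishesOn

lemma insert_compl_singleton (k : ℤ) : insert k ({k}ᶜ : Set ℤ) = univ := by
  ext l
  simp [em]

lemma eqOn_update (ν : ℤ → ℂ) {k : ℤ} (c : ℂ) {I : Set ℤ} (hk : k ∉ I) :
    EqOn ν (update ν k c) I := fun l hl => by
  rw [update_of_ne]
  rintro rfl
  exact hk hl

/-- A function of the Paley-Wiener space that vanishes at all nodes is zero. -/
def IsComplete (ν : ℤ → ℂ) : Prop := ∀ W ∈ PW, VanishesOn W ν univ → W = 0

/-- There are nonzero functions of the Paley-Wiener space that vanish at all nodes but one. -/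
def HasGenerators (ν : ℤ → ℂ) : Prop := ∀ k, ∃ V ∈ PW, V ≠ 0 ∧ VanishesOn V ν {k}ᶜ

lemma PW.sub_mul_of_sub_mul {G : ℂ → ℂ} (hG : G ∈ PW) {c : ℂ}
    (h : (fun s => (s - c) * G s) ∈ PW) (d : ℂ) : (fun s => (s - d) * G s) ∈ PW := by
  have := PW.add_mem h (PW.smul_mem (c - d) hG)
  convert this using 1
  ext s
  simp only [Pi.add_apply, Pi.smul_apply, smul_eq_mul]
  ring

/-- Exchange of factors: if `W = (s - c) G` vanishes at the new nodes, then `(s - ν k) G` is in `PW`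
and vanishes at the old ones. -/
lemma IsComplete.update {ν : ℤ → ℂ} (h : IsComplete ν) (k : ℤ) (c : ℂ) :
    IsComplete (update ν k c) := by
  intro W hW hv
  have h0 := hv.apply_eq_zero (mem_univ k)
  rw [update_self] at h0
  obtain ⟨G, hG, hWG⟩ := PW.exists_div hW h0
  have hWe : W = fun s => (s - Function.update ν k c k) * G s := by
    rw [update_self]
    exact funext hWG
  have hGd := PW.differentiable hG
  have hk : k ∉ ({k}ᶜ : Set ℤ) := fun hk => hk rfl
  rw [hWe, ← insert_compl_singleton k, VanishesOn.sub_mul_iff hGd hk] at hv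
  have h1 := (VanishesOn.sub_mul_iff hGd hk).2 (hv.congr_nodes (eqOn_update ν c hk).symm)
  rw [insert_compl_singleton] at h1
  rw [hWe] at hW
  have h2 := h _ (PW.sub_mul_of_sub_mul hG hW (ν k)) h1
  have h3 : G = 0 := eq_of_sub_mul_eq hGd.continuous continuous_zero (ν k) fun s => by
    rw [Pi.zero_apply, mul_zero]
    exact congrFun h2 s
  rw [hWe, h3]
  ext s
  simp

lemma compl_singleton_eq_insert {k l : ℤ} (h : l ≠ k) :
    ({k}ᶜ : Set ℤ) = insert l ({k, l}ᶜ : Set ℤ) := by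
  ext i
  simp only [mem_compl_iff, mem_singleton_iff, mem_insert_iff]
  constructor
  · intro hi
    by_cases hl : i = l
    · exact Or.inl hl
    · exact Or.inr (not_or.2 ⟨hi, hl⟩)
  · rintro (rfl | hi)
    · exact h
    · exact fun hk => hi (Or.inl hk)

lemma HasGenerators.update {ν : ℤ → ℂ} (h : HasGenerators ν) (l : ℤ) (c : ℂ) :
    HasGenerators (update ν l c) := by
  intro k
  obtain ⟨V, hV, hV0, hv⟩ := h k
  by_cases hkl : l = k
  · subst hkl
    exact ⟨V, hV, hV0, hv.congr_nodes (eqOn_update ν c fun h => h rfl)⟩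
  · have hl : l ∉ ({k, l}ᶜ : Set ℤ) := fun h => h (Or.inr rfl)
    obtain ⟨G, hG, hVG⟩ := PW.exists_div hV (hv.apply_eq_zero (k := l) hkl)
    have hGd := PW.differentiable hG
    have hVe : V = fun s => (s - ν l) * G s := funext hVG
    rw [compl_singleton_eq_insert hkl, hVe, VanishesOn.sub_mul_iff hGd hl] at hv
    have h1 := (VanishesOn.sub_mul_iff hGd hl).2 (hv.congr_nodes (eqOn_update ν c hl))
    rw [← compl_singleton_eq_insert hkl] at h1
    refine ⟨_, PW.sub_mul_of_sub_mul hG (hVe ▸ hV) _, fun h0 => hV0 ?_, h1⟩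
    have h3 : G = 0 := eq_of_sub_mul_eq hGd.continuous continuous_zero _ fun s => by
      rw [Pi.zero_apply, mul_zero]
      exact congrFun h0 s
    rw [hVe, h3]
    ext s
    simp

/-- Reduces statements about nodes asymptotic to the integers to nodes uniformly close to them, from
which they differ in finitely many places. -/
lemma update_induction {P : (ℤ → ℂ) → Prop} (hP : ∀ ν k c, P ν → P (update ν k c)) {ν ν' : ℤ → ℂ}
    (hfin : {k | ν k ≠ ν' k}.Finite) (h : P ν) : P ν' := by
  obtain ⟨F, hF⟩ : ∃ F : Finset ℤ, ∀ k ∉ F, ν k = ν' k :=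
    ⟨hfin.toFinset, fun k hk => by simpa using hk⟩
  clear hfin
  induction F using Finset.induction_on generalizing ν with
  | empty =>
    obtain rfl : ν = ν' := funext fun k => hF k (Finset.notMem_empty k)
    exact h
  | insert a F ha ih =>
    refine ih (hP ν a (ν' a) h) fun k hk => ?_
    by_cases hka : k = a
    · subst hka
      rw [update_self]
    · rw [update_of_ne hka]
      exact hF k (by simp [hka, hk])

lemma injective_of_norm_sub_le {ν : ℤ → ℂ} (h : ∀ k : ℤ, ‖ν k - k‖ ≤ 1 / 10) : Injective ν := by
  intro k l hkl
  by_contra hne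
  have h1 : ‖((k - l : ℤ) : ℂ)‖ ≤ 1 / 5 := by
    have : ((k - l : ℤ) : ℂ) = (ν l - l) - (ν k - k) := by
      rw [hkl]; push_cast; ring
    rw [this]
    have := norm_sub_le (ν l - l) (ν k - k)
    linarith [h k, h l]
  rw [Complex.norm_intCast] at h1
  have h2 : (1 : ℝ) ≤ |((k - l : ℤ) : ℝ)| := by
    exact_mod_cast Int.one_le_abs (sub_ne_zero.2 hne)
  linarith

lemma memℓp_congr_finite {f g : ℤ → ℂ} (hf : Memℓp f 2) (h : {k | f k ≠ g k}.Finite) :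
    Memℓp g 2 := by
  rw [memℓp_gen_iff (by norm_num)] at hf ⊢
  refine hf.congr_cofinite ?_
  have : ∀ᶠ k in cofinite, f k = g k := h
  filter_upwards [this] with k hk
  rw [hk]

lemma isComplete_hasGenerators_of_norm_le {ν : ℤ → ℂ} (h : ∀ k : ℤ, ‖ν k - k‖ ≤ 1 / 10) :
    IsComplete ν ∧ HasGenerators ν := by
  constructor
  · intro W hW hv
    refine PW.eq_zero_of_samples h hW fun k => ?_
    rw [add_sub_cancel]
    exact hv.apply_eq_zero (mem_univ k)
  · intro k
    have hd : Memℓp (Pi.single k 1 : ℤ → ℂ) 2 := by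
      refine memℓp_congr_finite (f := 0) zero_memℓp ((finite_singleton k).subset fun l hl => ?_)
      by_contra hlk
      exact hl (by rw [Pi.single_eq_of_ne hlk]; rfl)
    obtain ⟨V, hV, hVd⟩ := PW.exists_samples h hd
    refine ⟨V, hV, fun h0 => ?_, VanishesOn.of_injOn (injective_of_norm_sub_le h).injOn
      (PW.differentiable hV) fun l hl => ?_⟩
    · have := hVd k
      rw [h0] at this
      simp at this
    · have := hVd l
      rwa [add_sub_cancel, Pi.single_eq_of_ne hl] at this

lemma exists_close_nodes {ν : ℤ → ℂ} (h : Tendsto (fun k : ℤ => ν k - k) cofinite (𝓝 0)) :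
    ∃ ν₀ : ℤ → ℂ, (∀ k : ℤ, ‖ν₀ k - k‖ ≤ 1 / 10) ∧ {k | ν₀ k ≠ ν k}.Finite := by
  classical
  have h1 : ∀ᶠ k : ℤ in cofinite, ‖ν k - k‖ ≤ 1 / 10 :=
    (tendsto_zero_iff_norm_tendsto_zero.1 h).eventually_le_const (by norm_num)
  refine ⟨fun k => if ‖ν k - k‖ ≤ 1 / 10 then ν k else k, fun k => ?_, ?_⟩
  · dsimp only
    split_ifs with hk
    · exact hk
    · norm_num
  · refine (eventually_cofinite.1 h1).subset fun k hk => ?_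
    by_contra hk'
    simp only [mem_ofPred_eq, not_not] at hk'
    exact hk (if_pos hk')

lemma isComplete_hasGenerators {ν : ℤ → ℂ} (h : Tendsto (fun k : ℤ => ν k - k) cofinite (𝓝 0)) :
    IsComplete ν ∧ HasGenerators ν := by
  obtain ⟨ν₀, h0, hfin⟩ := exists_close_nodes h
  exact update_induction (P := fun ν => IsComplete ν ∧ HasGenerators ν)
    (fun ν k c h => ⟨h.1.update k c, h.2.update k c⟩) hfin (isComplete_hasGenerators_of_norm_le h0)

/-- The coefficient `c` cancels the coefficient of `(s - z)^r` in `f`, which is possible because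
that of `g` is nonzero. -/
lemma exists_lt_analyticOrderAt_add_smul {f g : ℂ → ℂ} {z : ℂ} (hf : AnalyticAt ℂ f z)
    (hg : AnalyticAt ℂ g z) {r : ℕ} (hfr : r ≤ analyticOrderAt f z) (hgr : analyticOrderAt g z = r) :
    ∃ c : ℂ, ((r : ℕ∞) + 1) ≤ analyticOrderAt (f + c • g) z := by
  obtain ⟨F, hF, hfF⟩ := (natCast_le_analyticOrderAt hf).1 hfr
  obtain ⟨G, hG, hG0, hgG⟩ := hg.analyticOrderAt_eq_natCast.1 hgr
  refine ⟨-(F z / G z), ?_⟩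
  have hpow : AnalyticAt ℂ (fun s : ℂ => s - z) z := by fun_prop
  have hFG : AnalyticAt ℂ (F + (-(F z / G z)) • G) z := hF.add (hG.const_smul)
  have h1 : f + (-(F z / G z)) • g =ᶠ[𝓝 z] (fun s : ℂ => s - z) ^ r * (F + (-(F z / G z)) • G) := by
    filter_upwards [hfF, hgG] with s h1 h2
    simp only [Pi.add_apply, Pi.smul_apply, Pi.mul_apply, Pi.pow_apply, smul_eq_mul, h1, h2]
    ring
  rw [analyticOrderAt_congr h1, analyticOrderAt_mul (hpow.pow r) hFG, analyticOrderAt_pow hpow,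
    show analyticOrderAt (fun s : ℂ => s - z) z = 1 from analyticOrderAt_id_sub_const_self,
    nsmul_one]
  gcongr
  rw [Order.one_le_iff_ne_zero, hFG.analyticOrderAt_ne_zero]
  simp [hG0]

/-- `θ` can be corrected by a function of the Paley-Wiener space so as to vanish at all nodes. -/
def Solvable (θ : ℂ → ℂ) (ν : ℤ → ℂ) : Prop := ∃ W ∈ PW, VanishesOn (θ + W) ν univ

/-- Adding a multiple of the generator `V` keeps the zeros at the nodes other than `k`. By
completeness `V` cannot vanish at all the new nodes, so its order at the new value equals the number
of other nodes there; a suitable multiple therefore raises the order of `θ + W` at that point by the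
one unit needed. -/
lemma Solvable.update {θ : ℂ → ℂ} (hθ : Differentiable ℂ θ) {ν : ℤ → ℂ} (hc : IsComplete ν)
    (hg : HasGenerators ν) (h : Solvable θ ν) (k : ℤ) (c : ℂ) : Solvable θ (update ν k c) := by
  obtain ⟨W, hW, hv⟩ := h
  obtain ⟨V, hV, hV0, hVv⟩ := hg k
  have hk : k ∉ ({k}ᶜ : Set ℤ) := fun h => h rfl
  have hv' := (hv.mono (subset_univ {k}ᶜ)).congr_nodes (eqOn_update ν c hk)
  have hVv' := hVv.congr_nodes (eqOn_update ν c hk)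
  set ν' := Function.update ν k c with hν'
  have hd : Differentiable ℂ (θ + W) := hθ.add (PW.differentiable hW)
  have hlt : analyticOrderAt V (ν' k) < {l | l ∈ ({k}ᶜ : Set ℤ) ∧ ν' l = ν' k}.encard + 1 := by
    by_contra hle
    have := hVv'.insert_of_le hk (not_lt.1 hle)
    rw [insert_compl_singleton] at this
    exact hV0 (hc.update k c V hV this)
  have hne : analyticOrderAt V (ν' k) ≠ ⊤ := hlt.ne_top
  have heq : {l | l ∈ ({k}ᶜ : Set ℤ) ∧ ν' l = ν' k}.encard = analyticOrderAt V (ν' k) :=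
    le_antisymm (hVv' _) (Order.le_of_lt_add_one hlt)
  obtain ⟨r, hr⟩ := ENat.ne_top_iff_exists.1 hne
  obtain ⟨a, ha⟩ := exists_lt_analyticOrderAt_add_smul (hd.analyticAt (ν' k))
    (PW.analyticAt hV (ν' k)) (r := r) (by rw [hr, ← heq]; exact hv' _) hr.symm
  refine ⟨W + a • V, PW.add_mem hW (PW.smul_mem a hV), ?_⟩
  rw [← add_assoc, ← insert_compl_singleton k]
  refine (hv'.add (hVv'.const_smul (PW.differentiable hV) a)).insert_of_le hk ?_
  rw [heq, ← hr]
  exact ha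

/-- Near the integers this is interpolation of `-θ` at simple nodes; the finitely many remaining
nodes are then moved to their places. -/
lemma solvable {θ : ℂ → ℂ} (hθ : Differentiable ℂ θ) {ν : ℤ → ℂ}
    (h : Tendsto (fun k : ℤ => ν k - k) cofinite (𝓝 0)) (hθν : Memℓp (fun k => θ (ν k)) 2) :
    Solvable θ ν := by
  obtain ⟨ν₀, h0, hfin⟩ := exists_close_nodes h
  have hbase := isComplete_hasGenerators_of_norm_le h0
  have hs : Solvable θ ν₀ := by
    have hd : Memℓp (fun k => -θ (ν₀ k)) 2 := by
      refine memℓp_congr_finite hθν.neg (hfin.subset fun k hk hk' => hk ?_)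
      simp only [Pi.neg_apply, hk']
    obtain ⟨W, hW, hWd⟩ := PW.exists_samples h0 hd
    refine ⟨W, hW, VanishesOn.of_injOn (injective_of_norm_sub_le h0).injOn
      (hθ.add (PW.differentiable hW)) fun k _ => ?_⟩
    have := hWd k
    rw [add_sub_cancel] at this
    rw [Pi.add_apply, this, add_neg_cancel]
  exact (update_induction (P := fun ν => (IsComplete ν ∧ HasGenerators ν) ∧ Solvable θ ν)
    (fun ν k c h => ⟨⟨h.1.1.update k c, h.1.2.update k c⟩, h.2.update hθ h.1.1 h.1.2 k c⟩) hfin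
    ⟨hbase, hs⟩).2

/-! ### Sine-type functions over the Paley–Wiener space: repairing finitely many zeros -/

/-- Polynomials of degree at most `r` with coefficients in the Paley-Wiener space. -/
def IsPolyPW : ℕ → (ℂ → ℂ) → Prop
  | 0, f => f ∈ PW
  | r + 1, f => ∃ G, IsPolyPW r G ∧ ∃ H ∈ PW, ∀ s, f s = s * G s + H s

namespace IsPolyPW

lemma succ : ∀ {r : ℕ} {f : ℂ → ℂ}, IsPolyPW r f → IsPolyPW (r + 1) f
  | 0, f, h => ⟨0, PW.zero_mem, f, h, fun s => by simp⟩
  | _ + 1, _, ⟨G, hG, H, hH, h⟩ => ⟨G, hG.succ, H, hH, h⟩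

lemma of_mem {f : ℂ → ℂ} (h : f ∈ PW) : ∀ r, IsPolyPW r f
  | 0 => h
  | r + 1 => (of_mem h r).succ

lemma add : ∀ {r : ℕ} {f g : ℂ → ℂ}, IsPolyPW r f → IsPolyPW r g → IsPolyPW r (f + g)
  | 0, _, _, hf, hg => PW.add_mem hf hg
  | _ + 1, _, _, ⟨G, hG, H, hH, h⟩, ⟨G', hG', H', hH', h'⟩ =>
    ⟨G + G', hG.add hG', H + H', PW.add_mem hH hH', fun s => by
      simp only [Pi.add_apply, h, h']; ring⟩

lemma smul (c : ℂ) : ∀ {r : ℕ} {f : ℂ → ℂ}, IsPolyPW r f → IsPolyPW r (c • f)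
  | 0, _, hf => PW.smul_mem c hf
  | _ + 1, _, ⟨G, hG, H, hH, h⟩ =>
    ⟨c • G, hG.smul c, c • H, PW.smul_mem c hH, fun s => by
      simp only [Pi.smul_apply, h, smul_eq_mul]; ring⟩

lemma differentiable : ∀ {r : ℕ} {f : ℂ → ℂ}, IsPolyPW r f → Differentiable ℂ f
  | 0, _, hf => PW.differentiable hf
  | _ + 1, f, ⟨G, hG, H, hH, h⟩ => by
    rw [show f = fun s => s * G s + H s from funext h]
    exact (differentiable_id.mul hG.differentiable).add (PW.differentiable hH)

lemma sub_mul {r : ℕ} {f : ℂ → ℂ} (h : IsPolyPW r f) (c : ℂ) :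
    IsPolyPW (r + 1) (fun s => (s - c) * f s) := by
  have h1 : IsPolyPW (r + 1) (fun s => s * f s) := ⟨f, h, 0, PW.zero_mem, fun s => by simp⟩
  convert h1.add (h.smul (-c)).succ using 1
  ext s
  simp only [Pi.add_apply, Pi.smul_apply, smul_eq_mul]
  ring

lemma exists_div : ∀ {r : ℕ} {f : ℂ → ℂ}, IsPolyPW (r + 1) f → ∀ {c : ℂ}, f c = 0 →
    ∃ g, IsPolyPW r g ∧ ∀ s, f s = (s - c) * g s
  | 0, f, ⟨G, hG, H, hH, h⟩, c, hc => by
    obtain ⟨g, hg, hg'⟩ := PW.exists_div (PW.add_mem (PW.smul_mem c hG) hH) (z := c) (by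
      rw [← hc, h]; rfl)
    refine ⟨G + g, PW.add_mem hG hg, fun s => ?_⟩
    have := hg' s
    simp only [Pi.add_apply, Pi.smul_apply, smul_eq_mul] at this ⊢
    rw [h, mul_add, ← this]
    ring
  | r + 1, f, ⟨G, hG, H, hH, h⟩, c, hc => by
    obtain ⟨g, hg, hg'⟩ := ((hG.smul c).add (of_mem hH (r + 1))).exists_div (c := c) (by
      rw [← hc, h]; rfl)
    refine ⟨G + g, hG.add hg.succ, fun s => ?_⟩
    have := hg' s
    simp only [Pi.add_apply, Pi.smul_apply, smul_eq_mul] at this ⊢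
    rw [h, mul_add, ← this]
    ring

end IsPolyPW

open Polynomial in
-- Take `c` with `V c ≠ 0` and subtract the multiple of `V` that makes `f` vanish at `c`. The
-- difference then vanishes at all nodes once the node `k` is moved to `c`. In degree zero it is
-- zero by completeness; otherwise dividing by `s - c` lowers the degree.
lemma exists_polynomial_of_vanishesOn {ν : ℤ → ℂ} (hc : IsComplete ν) {k : ℤ} {V : ℂ → ℂ}
    (hV : V ∈ PW) (hV0 : V ≠ 0) (hVv : VanishesOn V ν {k}ᶜ) :
    ∀ {r : ℕ} {f : ℂ → ℂ}, IsPolyPW r f → VanishesOn f ν {k}ᶜ →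
      ∃ P : ℂ[X], ∀ s, f s = V s * P.eval s := by
  obtain ⟨c, hVc⟩ : ∃ c, V c ≠ 0 := by
    by_contra! h
    exact hV0 (funext h)
  have hk : k ∉ ({k}ᶜ : Set ℤ) := fun h => h rfl
  have hVv' := hVv.congr_nodes (eqOn_update ν c hk)
  have key : ∀ {f : ℂ → ℂ}, Differentiable ℂ f → VanishesOn f ν {k}ᶜ → f c = 0 →
      VanishesOn f (update ν k c) univ := by
    intro f hf hv h0
    rw [← insert_compl_singleton k]
    refine (hv.congr_nodes (eqOn_update ν c hk)).insert_of_le hk ?_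
    -- No other node lies at `c`, because `V` vanishes at all of them; a simple zero suffices.
    have : {l | l ∈ ({k}ᶜ : Set ℤ) ∧ update ν k c l = update ν k c k} = ∅ := by
      refine eq_empty_iff_forall_notMem.2 fun l hl => hVc ?_
      rw [← update_self k c ν, ← hl.2]
      exact hVv'.apply_eq_zero hl.1
    rw [this, encard_empty, zero_add, Order.one_le_iff_ne_zero,
      (hf.analyticAt _).analyticOrderAt_ne_zero, update_self]
    exact h0
  intro r
  induction r with
  | zero =>
    intro f hf hv
    refine ⟨C (f c / V c), fun s => ?_⟩
    have h1 : f + (-(f c / V c)) • V = 0 := by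
      refine hc.update k c _ (PW.add_mem hf (PW.smul_mem _ hV))
        (key (hf.differentiable.add ((PW.differentiable hV).const_smul _))
          (hv.add (hVv.const_smul (PW.differentiable hV) _)) ?_)
      simp [hVc]
    have h2 := congrFun h1 s
    simp only [Pi.add_apply, Pi.smul_apply, smul_eq_mul, Pi.zero_apply] at h2
    rw [eval_C]
    linear_combination h2
  | succ r ih =>
    intro f hf hv
    have hg : IsPolyPW (r + 1) (f + (-(f c / V c)) • V) :=
      hf.add ((IsPolyPW.of_mem hV _).smul _)
    have hg0 : (f + (-(f c / V c)) • V) c = 0 := by simp [hVc]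
    have hgv := key hg.differentiable (hv.add (hVv.const_smul (PW.differentiable hV) _)) hg0
    obtain ⟨g, hgp, hgf⟩ := hg.exists_div hg0
    rw [show f + (-(f c / V c)) • V = fun s => (s - update ν k c k) * g s by
      rw [update_self]; exact funext hgf, ← insert_compl_singleton k,
      VanishesOn.sub_mul_iff hgp.differentiable hk] at hgv
    obtain ⟨P, hP⟩ := ih hgp (hgv.congr_nodes (eqOn_update ν c hk).symm)
    refine ⟨C (f c / V c) + (X - C c) * P, fun s => ?_⟩
    have h2 := hgf s
    simp only [Pi.add_apply, Pi.smul_apply, smul_eq_mul, hP] at h2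
    simp only [eval_add, eval_C, eval_mul, eval_sub, eval_X]
    linear_combination h2

open Polynomial in
-- `E` is the generator for `k` divided by the factors `s - ν a`, `a ∈ F`. The quotient `f / E` is
-- unchanged when `f` is multiplied by the same factors, so the case of one omitted node applies, at
-- a higher degree.
lemma exists_generator {ν : ℤ → ℂ} (hc : IsComplete ν) (hg : HasGenerators ν) (k : ℤ)
    (F : Finset ℤ) (hk : k ∉ F) :
    ∃ E ∈ PW, VanishesOn E ν (insert k F : Finset ℤ)ᶜ ∧ ∀ (r : ℕ) (f : ℂ → ℂ), IsPolyPW r f →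
      VanishesOn f ν (insert k F : Finset ℤ)ᶜ → ∃ P : ℂ[X], ∀ s, f s = E s * P.eval s := by
  induction F using Finset.induction_on with
  | empty =>
    obtain ⟨V, hV, hV0, hVv⟩ := hg k
    refine ⟨V, hV, ?_, fun r f hf hv => exists_polynomial_of_vanishesOn hc hV hV0 hVv hf ?_⟩
    · simpa using hVv
    · simpa using hv
  | insert a F ha ih =>
    obtain ⟨E, hE, hEv, hEP⟩ := ih fun h => hk (Finset.mem_insert_of_mem h)
    have hka : k ≠ a := fun h => hk (h ▸ Finset.mem_insert_self a F)
    have haI : a ∉ (((insert k (insert a F) : Finset ℤ) : Set ℤ)ᶜ) := fun h => h (by simp)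
    have hI : (((insert k F : Finset ℤ) : Set ℤ)ᶜ) =
        insert a (((insert k (insert a F) : Finset ℤ) : Set ℤ)ᶜ) := by
      ext i
      simp only [Finset.coe_insert, mem_compl_iff, mem_insert_iff, Finset.mem_coe]
      constructor
      · intro h
        by_cases hia : i = a
        · exact Or.inl hia
        · exact Or.inr fun h' => h (by tauto)
      · rintro (rfl | h)
        · rintro (h | h)
          · exact hka h.symm
          · exact ha h
        · exact fun h' => h (by tauto)
    obtain ⟨G, hG, hEG⟩ := PW.exists_div hE (hEv.apply_eq_zero (k := a) (by rw [hI]; simp))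
    have hGd := PW.differentiable hG
    refine ⟨G, hG, ?_, fun r f hf hv => ?_⟩
    · rwa [hI, show E = fun s => (s - ν a) * G s from funext hEG,
        VanishesOn.sub_mul_iff hGd haI] at hEv
    · obtain ⟨P, hP⟩ := hEP _ _ (hf.sub_mul (ν a)) (by
        rw [hI, VanishesOn.sub_mul_iff hf.differentiable haI]
        exact hv)
      refine ⟨P, fun s => congrFun (eq_of_sub_mul_eq (f := f) (g := fun s => G s * P.eval s)
        hf.differentiable.continuous (hGd.continuous.mul P.continuous) (ν a) fun s => ?_) s⟩
      rw [hP, hEG]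
      ring

open Polynomial in
-- Write `Δ = E P`. As `Δ ∉ PW`, the polynomial `P` is not constant, and one of its roots serves as
-- the new node `k`.
lemma exists_update_vanishesOn {ν : ℤ → ℂ} (hc : IsComplete ν) (hg : HasGenerators ν) {Δ : ℂ → ℂ}
    (hΔ : IsPolyPW 1 Δ) (hΔ' : Δ ∉ PW) {k : ℤ} {F : Finset ℤ} (hk : k ∉ F)
    (hv : VanishesOn Δ ν (insert k F : Finset ℤ)ᶜ) :
    ∃ c, VanishesOn Δ (update ν k c) (F : Set ℤ)ᶜ := by
  obtain ⟨E, hE, hEv, hEP⟩ := exists_generator hc hg k F hk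
  obtain ⟨P, hP⟩ := hEP 1 Δ hΔ hv
  have hdeg : P.degree ≠ 0 := by
    intro h
    refine hΔ' ?_
    rw [show Δ = P.coeff 0 • E by
      ext s
      rw [hP, eq_C_of_degree_le_zero h.le, eval_C, Pi.smul_apply, smul_eq_mul, coeff_C_zero, mul_comm]]
    exact PW.smul_mem _ hE
  obtain ⟨c, hcr⟩ := IsAlgClosed.exists_root P hdeg
  obtain ⟨P', hP'⟩ := dvd_iff_isRoot.2 hcr
  refine ⟨c, ?_⟩
  have hkI : k ∉ (((insert k F : Finset ℤ) : Set ℤ)ᶜ) := fun h => h (by simp)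
  have hI : ((F : Set ℤ)ᶜ) = insert k (((insert k F : Finset ℤ) : Set ℤ)ᶜ) := by
    ext i
    simp only [Finset.coe_insert, mem_compl_iff, mem_insert_iff, Finset.mem_coe]
    constructor
    · intro h
      by_cases hia : i = k
      · exact Or.inl hia
      · exact Or.inr fun h' => h (by tauto)
    · rintro (rfl | h)
      · exact hk
      · exact fun h' => h (Or.inr h')
  have hPd : Differentiable ℂ (fun s => P'.eval s) := P'.differentiable
  have hEd := PW.differentiable hE
  have h1 := (hEv.mul_right hEd hPd).congr_nodes (eqOn_update ν c hkI)
  rw [hI, show Δ = fun s => (s - update ν k c k) * (E * fun s => P'.eval s) s by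
    ext s
    rw [hP, hP', update_self, eval_mul, eval_sub, eval_X, eval_C, Pi.mul_apply]
    ring]
  exact (VanishesOn.sub_mul_iff (hEd.mul hPd) hkI).2 h1

/-- Finitely many nodes can be adjusted so that a function of sine type vanishes at all nodes. -/
lemma exists_vanishesOn_univ {Δ : ℂ → ℂ} (hΔ : IsPolyPW 1 Δ) (hΔ' : Δ ∉ PW) (F : Finset ℤ) :
    ∀ {ν : ℤ → ℂ}, IsComplete ν → HasGenerators ν → VanishesOn Δ ν (F : Set ℤ)ᶜ →
      ∃ ν', EqOn ν ν' (F : Set ℤ)ᶜ ∧ VanishesOn Δ ν' univ := by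
  induction F using Finset.induction_on with
  | empty =>
    intro ν _ _ hv
    exact ⟨ν, fun _ _ => rfl, by simpa using hv⟩
  | insert k F hk ih =>
    intro ν hc hg hv
    obtain ⟨c, hv'⟩ := exists_update_vanishesOn hc hg hΔ hΔ' hk hv
    obtain ⟨ν', h1, h2⟩ := ih (hc.update k c) (hg.update k c) hv'
    refine ⟨ν', fun i hi => ?_, h2⟩
    simp only [Finset.coe_insert, mem_compl_iff, mem_insert_iff, not_or] at hi
    rw [← h1 hi.2, update_of_ne hi.1]

/-- If `Δ` had an excess zero, dividing it out would leave a function of `PW` that still vanishes at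
all nodes. By completeness it would be zero, and then `Δ = 0 ∈ PW`. -/
lemma encard_eq_analyticOrderAt {Δ : ℂ → ℂ} (hΔ : IsPolyPW 1 Δ) (hΔ' : Δ ∉ PW) {ν : ℤ → ℂ}
    (hc : IsComplete ν) (hv : VanishesOn Δ ν univ) (z : ℂ) :
    {k | ν k = z}.encard = analyticOrderAt Δ z := by
  have hset : ∀ w, {k | k ∈ (univ : Set ℤ) ∧ ν k = w} = {k | ν k = w} := fun w => by simp
  refine le_antisymm (hset z ▸ hv z) (not_lt.1 fun hlt => ?_)
  have hle := Order.add_one_le_of_lt hlt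
  have h0 : Δ z = 0 := apply_eq_zero_of_analyticOrderAt_ne_zero (pos_of_gt hlt).ne'
  obtain ⟨g, hg, hΔg⟩ := hΔ.exists_div h0
  have hgd := hg.differentiable
  have hΔe : Δ = fun s => (s - z) * g s := funext hΔg
  have hg0 : g = 0 := by
    refine hc g hg fun w => ?_
    by_cases hw : z = w
    · subst hw
      rw [hset]
      rw [hΔe, analyticOrderAt_sub_mul hgd, if_pos rfl, add_comm] at hle
      exact (ENat.add_le_add_iff_left ENat.one_ne_top).1 hle
    · have := hv w
      rwa [hΔe, analyticOrderAt_sub_mul hgd, if_neg hw, zero_add] at this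
  refine hΔ' ?_
  rw [show Δ = 0 by rw [hΔe, hg0]; ext s; simp]
  exact PW.zero_mem

end PaleyWiener

lemma memLp_comp_affine {w : ℝ → ℂ} {S : Set ℝ} (hS : MeasurableSet S)
    (hw : MemLp w 2 (volume.restrict S)) {c : ℝ} (hc : c ≠ 0) (d : ℝ) :
    MemLp (fun x => w (c * x + d)) 2 (volume.restrict ((fun x => c * x + d) ⁻¹' S)) := by
  let e : ℝ → ℝ := fun x => c * x + d
  have he : Measurable e := by fun_prop
  have h1 : volume.map e = ENNReal.ofReal |c⁻¹| • (volume : Measure ℝ) := by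
    have h2 : e = (fun x => x + d) ∘ (fun x => c * x) := rfl
    rw [h2, ← Measure.map_map (by fun_prop) (by fun_prop), Real.map_volume_mul_left hc,
      Measure.map_smul, map_add_right_eq_self]
  have h3 : (volume.restrict (e ⁻¹' S)).map e = ENNReal.ofReal |c⁻¹| • volume.restrict S := by
    rw [← Measure.restrict_map he hS, h1, Measure.restrict_smul]
  have h4 : MemLp w 2 ((volume.restrict (e ⁻¹' S)).map e) := by
    rw [h3]
    exact hw.smul_measure ENNReal.ofReal_ne_top
  exact h4.comp_of_map he.aemeasurable

/-! ### Zeros of `c sin πs + W(s)` with `W` in the Paley–Wiener space -/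

namespace PaleyWiener

open Function Complex

lemma Memℓp.tendsto_zero {f : ℤ → ℂ} (hf : Memℓp f 2) : Tendsto f cofinite (𝓝 0) := by
  rw [memℓp_gen_iff (by norm_num)] at hf
  rw [tendsto_zero_iff_norm_tendsto_zero]
  have h1 := hf.tendsto_cofinite_zero.sqrt
  simpa [Real.sqrt_sq (norm_nonneg _)] using h1

lemma memℓp_of_eventually_le {f g : ℤ → ℂ} (hf : Memℓp f 2) {C : ℝ}
    (h : ∀ᶠ k in cofinite, ‖g k‖ ≤ C * ‖f k‖) : Memℓp g 2 := by
  rw [memℓp_gen_iff (by norm_num)] at hf ⊢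
  refine Summable.of_norm_bounded_eventually (hf.mul_left (C ^ 2)) ?_
  filter_upwards [h] with k hk
  have h2 : ∀ x : ℝ, x ^ (2 : ℝ≥0∞).toReal = x ^ 2 := fun x => by norm_num
  rw [h2, h2, Real.norm_of_nonneg (by positivity), ← mul_pow]
  exact pow_le_pow_left₀ (norm_nonneg _) hk 2

/-- A Fourier-Laplace transform of a function with support in a smaller interval belongs to the
Paley-Wiener space. -/
lemma PW.comp_div {W : ℂ → ℂ} (hW : W ∈ PW) {m : ℝ} (hm : 1 ≤ m) : (fun s => W (s / m)) ∈ PW := by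
  obtain ⟨w, hw, hWw⟩ := PW.exists_memLp hW
  have hm0 : 0 < m := by linarith
  have hpi := Real.pi_pos
  have hle : -(Real.pi / m) ≤ Real.pi / m := by have := div_pos hpi hm0; linarith
  have hpm : Real.pi / m ≤ Real.pi := div_le_self hpi.le hm
  have hpre : (fun x => m * x + 0) ⁻¹' Ioc (-Real.pi) Real.pi = Ioc (-(Real.pi / m)) (Real.pi / m) := by
    ext x
    simp only [mem_preimage, mem_Ioc, add_zero]
    rw [← neg_div, div_lt_iff₀ hm0, le_div_iff₀ hm0, mul_comm]
  have h1 := memLp_comp_affine measurableSet_Ioc hw hm0.ne' 0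
  rw [hpre] at h1
  let v : ℝ → ℂ := (Ioc (-(Real.pi / m)) (Real.pi / m)).indicator (fun x => m * w (m * x + 0))
  have hv : MemLp v 2 (volume.restrict (Ioc (-Real.pi) Real.pi)) :=
    ((memLp_indicator_iff_restrict measurableSet_Ioc).2 (h1.const_mul (m : ℂ))).restrict _
  have h2 := mem_PW_of_memLp hv
  convert h2 using 1
  ext s
  rw [hWw]
  have h3 : ∀ x : ℝ, v x * cexp (-(I * s * x)) = (Ioc (-(Real.pi / m)) (Real.pi / m)).indicator
      (fun x : ℝ => m * w (m * x + 0) * cexp (-(I * s * x))) x := by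
    intro x
    simp only [v, indicator]
    split_ifs <;> simp
  simp only [h3]
  have h5 : ∀ u : ℝ → ℂ, ∫ x in (-Real.pi)..Real.pi,
      (Ioc (-(Real.pi / m)) (Real.pi / m)).indicator u x =
      ∫ x in (-(Real.pi / m))..(Real.pi / m), u x := by
    intro u
    rw [intervalIntegral.integral_of_le (by linarith : -Real.pi ≤ Real.pi),
      setIntegral_indicator measurableSet_Ioc,
      inter_eq_right.2 (Ioc_subset_Ioc (by linarith) hpm), ← intervalIntegral.integral_of_le hle]
  rw [h5]
  have h4 := intervalIntegral.smul_integral_comp_mul_add (a := -(Real.pi / m)) (b := Real.pi / m)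
    (fun x : ℝ => w x * cexp (-(I * (s / m) * x))) m 0
  rw [← intervalIntegral.integral_smul] at h4
  have e1 : m * -(Real.pi / m) + 0 = -Real.pi := by field_simp; ring
  have e2 : m * (Real.pi / m) + 0 = Real.pi := by field_simp; ring
  rw [e1, e2] at h4
  rw [← h4]
  refine intervalIntegral.integral_congr fun x _ => ?_
  have hmc : (m : ℂ) ≠ 0 := by exact_mod_cast hm0.ne'
  simp only [real_smul]
  rw [show -(I * (s / m) * ((m * x + 0 : ℝ) : ℂ)) = -(I * s * x) by push_cast; field_simp; ring]
  ring

lemma isPolyPW_sin : IsPolyPW 1 (fun s => sin (Real.pi * s)) := by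
  have hmem : MemLp (fun _ : ℝ => (1 / 2 : ℂ)) 2 (volume.restrict (Ioc (-Real.pi) Real.pi)) :=
    memLp_const _
  refine ⟨_, mem_PW_of_memLp hmem, 0, PW.zero_mem, fun s => ?_⟩
  rw [Pi.zero_apply, add_zero]
  by_cases hs : s = 0
  · simp [hs]
  rw [intervalIntegral.integral_const_mul]
  have h1 : -(I * s) ≠ 0 := neg_ne_zero.2 (mul_ne_zero I_ne_zero hs)
  have h2 := integral_exp_mul_complex (a := -Real.pi) (b := Real.pi) h1
  simp only [neg_mul] at h2 ⊢
  rw [h2, Complex.sin]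
  push_cast
  field_simp
  rw [I_sq]
  ring_nf

lemma norm_sin_int_add (n : ℤ) (ζ : ℂ) :
    ‖sin (Real.pi * (n + ζ))‖ = ‖sin (Real.pi * ζ)‖ := by
  have h1 : ‖cos (n * Real.pi)‖ = 1 := by
    have h2 : cos (n * Real.pi) ^ 2 = 1 := by
      rw [Complex.cos_sq', Complex.sin_int_mul_pi, zero_pow two_ne_zero, sub_zero]
    have h3 := congrArg norm h2
    rw [norm_pow, norm_one] at h3
    exact (pow_eq_one_iff_of_nonneg (norm_nonneg _) two_ne_zero).1 h3
  rw [show (Real.pi : ℂ) * (n + ζ) = Real.pi * ζ + n * Real.pi by ring, Complex.sin_add,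
    Complex.sin_int_mul_pi, mul_zero, add_zero, norm_mul, h1, mul_one]

/-- The derivative at `0` is `π`, between `3` and `4`, and near `0` the linearisation error is at
most `|ζ|`. -/
lemma exists_norm_sin_bounds : ∃ ρ : ℝ, 0 < ρ ∧ ∀ ζ : ℂ, ‖ζ‖ ≤ ρ →
    ‖ζ‖ ≤ ‖sin (Real.pi * ζ)‖ ∧ ‖sin (Real.pi * ζ)‖ ≤ 5 * ‖ζ‖ := by
  have h1 : HasDerivAt (fun ζ : ℂ => sin (Real.pi * ζ)) Real.pi 0 := by
    have h2 : HasDerivAt (fun ζ : ℂ => (Real.pi : ℂ) * ζ) Real.pi 0 := by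
      simpa using! (hasDerivAt_id (0 : ℂ)).const_mul (Real.pi : ℂ)
    simpa using! h2.csin
  have h2 := (hasDerivAt_iff_isLittleO.1 h1).def one_pos
  obtain ⟨ρ, hρ, hb⟩ := Metric.eventually_nhds_iff_ball.1 h2
  refine ⟨ρ / 2, by positivity, fun ζ hζ => ?_⟩
  have h3 := hb ζ (by rw [Metric.mem_ball, dist_zero_right]; linarith)
  simp only [mul_zero, sin_zero, sub_zero, smul_eq_mul, one_mul] at h3
  have h4 : ‖ζ * Real.pi‖ = ‖ζ‖ * Real.pi := by
    rw [norm_mul, norm_real, Real.norm_of_nonneg Real.pi_pos.le]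
  have h5 := norm_sub_norm_le (ζ * Real.pi) (sin (Real.pi * ζ))
  have h6 := norm_sub_norm_le (sin (Real.pi * ζ)) (ζ * Real.pi)
  rw [norm_sub_rev] at h5
  rw [h4] at h5 h6
  have := Real.pi_gt_three
  have := Real.pi_lt_four
  have := norm_nonneg ζ
  constructor <;> nlinarith

section sineType

variable {W : ℂ → ℂ} {c : ℂ}

lemma isPolyPW_sineType (hW : W ∈ PW) (c : ℂ) :
    IsPolyPW 1 (fun s => c * sin (Real.pi * s) + W s) :=
  (isPolyPW_sin.smul c).add (IsPolyPW.of_mem hW 1)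

/-- Functions of `PW` tend to zero along the half-integers, where `c sin πs` has constant modulus
`|c|`. -/
lemma sineType_notMem_PW (hW : W ∈ PW) (hc : c ≠ 0) :
    (fun s => c * sin (Real.pi * s) + W s) ∉ PW := by
  intro h
  have h1 : (fun s => c * sin (Real.pi * s)) ∈ PW := by
    convert PW.sub_mem h hW using 1
    ext s
    simp
  have h2 := Memℓp.tendsto_zero (PW.memℓp_samples h1 (κ := fun _ => 1 / 2) fun _ => le_rfl)
  have h3 : ∀ k : ℤ, ‖c * sin (Real.pi * (k + 1 / 2))‖ = ‖c‖ := by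
    intro k
    rw [norm_mul, norm_sin_int_add, show (Real.pi : ℂ) * (1 / 2) = Real.pi / 2 by ring,
      Complex.sin_pi_div_two, norm_one, mul_one]
  have h4 := h2.norm
  simp only [h3, norm_zero] at h4
  exact norm_ne_zero_iff.2 hc (tendsto_nhds_unique tendsto_const_nhds h4)

/-- Minimum principle on the disc of radius `ρ` about `n`. If `|W| < |c|ρ/2` on the disc, the
function is larger than `|c|ρ/2` on the circle, but at the centre it equals `W(n)`, so it must
vanish inside. The maximum of `|W|` over the disc is attained at a point `n + κ n`; such samples are
in `ℓ²`, hence tend to zero. -/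
lemma exists_zeros_near_int (hW : W ∈ PW) (hc : c ≠ 0) :
    ∃ ζ : ℤ → ℂ, Tendsto ζ cofinite (𝓝 0) ∧
      ∀ᶠ n : ℤ in cofinite, c * sin (Real.pi * (n + ζ n)) + W (n + ζ n) = 0 := by
  obtain ⟨ρ, hρ, hsin⟩ := exists_norm_sin_bounds
  have hWd := PW.differentiable hW
  have hmax : ∀ n : ℤ, ∃ κ ∈ Metric.closedBall (0 : ℂ) ρ,
      ∀ ζ ∈ Metric.closedBall (0 : ℂ) ρ, ‖W (n + ζ)‖ ≤ ‖W (n + κ)‖ := by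
    intro n
    have hcont : Continuous fun ζ : ℂ => ‖W (n + ζ)‖ :=
      (hWd.continuous.comp (continuous_const.add continuous_id)).norm
    obtain ⟨κ, hκ, h⟩ := (isCompact_closedBall (0 : ℂ) ρ).exists_isMaxOn
      ⟨0, Metric.mem_closedBall_self hρ.le⟩ hcont.continuousOn
    exact ⟨κ, hκ, fun ζ hζ => h hζ⟩
  choose κ hκ hκmax using hmax
  have hM : Tendsto (fun n : ℤ => ‖W (n + κ n)‖) cofinite (𝓝 0) :=
    tendsto_zero_iff_norm_tendsto_zero.1 (Memℓp.tendsto_zero (PW.memℓp_samples hW fun n => by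
      simpa using hκ n))
  have hcn : 0 < ‖c‖ := norm_pos_iff.2 hc
  have hex : ∀ n : ℤ, ∃ ζ : ℂ, ‖W (n + κ n)‖ < ‖c‖ * ρ / 2 → ‖ζ‖ ≤ ρ ∧
      c * sin (Real.pi * (n + ζ)) + W (n + ζ) = 0 := by
    intro n
    by_contra! hno
    have hlt := (hno 0).1
    have hno' : ∀ ζ : ℂ, ‖ζ‖ ≤ ρ → c * sin (Real.pi * (n + ζ)) + W (n + ζ) ≠ 0 := fun ζ => (hno ζ).2
    let f : ℂ → ℂ := fun ζ => c * sin (Real.pi * (n + ζ)) + W (n + ζ)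
    have hfd : Differentiable ℂ f := by
      have h1 : Differentiable ℂ fun ζ : ℂ => sin (Real.pi * (n + ζ)) := by fun_prop
      exact (h1.const_mul c).add (hWd.comp ((differentiable_const _).add differentiable_id))
    have hinv : DiffContOnCl ℂ (fun ζ => (f ζ)⁻¹) (Metric.ball 0 ρ) := by
      refine hfd.diffContOnCl.inv fun ζ hζ => hno' ζ ?_
      rw [closure_ball _ hρ.ne'] at hζ
      simpa using hζ
    have hbound : ∀ ζ ∈ frontier (Metric.ball (0 : ℂ) ρ), ‖(f ζ)⁻¹‖ ≤ (‖c‖ * ρ / 2)⁻¹ := by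
      intro ζ hζ
      rw [frontier_ball _ hρ.ne', mem_sphere_zero_iff_norm] at hζ
      rw [norm_inv]
      refine inv_anti₀ (by positivity) ?_
      have h1 : ‖c‖ * ρ ≤ ‖c * sin (Real.pi * (n + ζ))‖ := by
        rw [norm_mul, norm_sin_int_add]
        have := (hsin ζ hζ.le).1
        rw [hζ] at this
        exact mul_le_mul_of_nonneg_left this hcn.le
      have h2 := norm_sub_le (f ζ) (W (n + ζ))
      simp only [f, add_sub_cancel_right] at h2
      have h3 := hκmax n ζ (by simpa using hζ.le)
      change ‖c‖ * ρ / 2 ≤ ‖c * sin (Real.pi * (n + ζ)) + W (n + ζ)‖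
      linarith
    have h0 := Complex.norm_le_of_forall_mem_frontier_norm_le Metric.isBounded_ball hinv hbound
      (subset_closure (Metric.mem_ball_self hρ))
    have hf0 : f 0 = W (n + 0) := by
      simp only [f]
      rw [add_zero, mul_comm (Real.pi : ℂ), Complex.sin_int_mul_pi, mul_zero, zero_add]
    have hf0' : f 0 ≠ 0 := hno' 0 (by simpa using hρ.le)
    rw [norm_inv] at h0
    have h4 := (inv_le_inv₀ (norm_pos_iff.2 hf0') (by positivity)).1 h0
    rw [hf0] at h4
    have := hκmax n 0 (Metric.mem_closedBall_self hρ.le)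
    linarith
  choose ζ hζ using hex
  have hev : ∀ᶠ n : ℤ in cofinite, ‖W (n + κ n)‖ < ‖c‖ * ρ / 2 :=
    hM.eventually_lt_const (by positivity)
  refine ⟨ζ, ?_, hev.mono fun n hn => (hζ n hn).2⟩
  have hlim : Tendsto (fun n : ℤ => ‖c‖⁻¹ * ‖W (n + κ n)‖) cofinite (𝓝 0) := by
    simpa using hM.const_mul ‖c‖⁻¹
  refine squeeze_zero_norm' (hev.mono fun n hn => ?_) hlim
  obtain ⟨h1, h2⟩ := hζ n hn
  have h3 : ‖c‖ * ‖sin (Real.pi * ζ n)‖ = ‖W (n + ζ n)‖ := by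
    rw [← norm_sin_int_add n, ← norm_mul, eq_neg_of_add_eq_zero_left h2, norm_neg]
  have h4 := hκmax n (ζ n) (by simpa using h1)
  have h5 := (hsin _ h1).1
  rw [inv_mul_eq_div, le_div_iff₀ hcn, mul_comm]
  exact (mul_le_mul_of_nonneg_left h5 hcn.le).trans (h3.trans_le h4)

/-- The zeros of a function of sine type are `ℓ²`-close to the integers. -/
lemma memℓp_zeros (hW : W ∈ PW) (hc : c ≠ 0) {lam : ℤ → ℂ}
    (hlim : Tendsto (fun n : ℤ => lam n - n) cofinite (𝓝 0))
    (h0 : ∀ n, c * sin (Real.pi * lam n) + W (lam n) = 0) :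
    Memℓp (fun n : ℤ => lam n - n) 2 := by
  classical
  obtain ⟨ρ, hρ, hsin⟩ := exists_norm_sin_bounds
  have hcn : 0 < ‖c‖ := norm_pos_iff.2 hc
  -- The deviation is cut off so that the sampling bound applies to all `n`; only finitely many
  -- terms change.
  let κ : ℤ → ℂ := fun n => if ‖lam n - n‖ ≤ ρ then lam n - n else 0
  have hκ : ∀ n, ‖κ n‖ ≤ ρ := by
    intro n
    simp only [κ]
    split_ifs with h
    · exact h
    · simpa using hρ.le
  refine memℓp_of_eventually_le (C := ‖c‖⁻¹) (PW.memℓp_samples hW hκ) ?_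
  filter_upwards [(tendsto_zero_iff_norm_tendsto_zero.1 hlim).eventually_le_const hρ] with n hn
  have hκn : κ n = lam n - n := if_pos hn
  have h1 : (n : ℂ) + κ n = lam n := by rw [hκn]; ring
  have h3 : ‖c‖ * ‖sin (Real.pi * κ n)‖ = ‖W (n + κ n)‖ := by
    rw [← norm_sin_int_add n, ← norm_mul, h1, eq_neg_of_add_eq_zero_left (h0 n), norm_neg]
  have h5 := (hsin _ (hκ n)).1
  rw [inv_mul_eq_div, le_div_iff₀ hcn, mul_comm, ← h3, ← hκn]
  exact mul_le_mul_of_nonneg_left h5 hcn.le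

lemma eq_of_norm_sub_le {lam : ℤ → ℂ} {n l : ℤ} (hn : ‖lam n - n‖ ≤ 1 / 10)
    (hl : ‖lam l - l‖ ≤ 1 / 10) (h : lam n = lam l) : n = l := by
  by_contra hne
  have h1 : ‖((n - l : ℤ) : ℂ)‖ ≤ 1 / 5 := by
    have : ((n - l : ℤ) : ℂ) = (lam l - l) - (lam n - n) := by
      rw [h]; push_cast; ring
    rw [this]
    have := norm_sub_le (lam l - l) (lam n - n)
    linarith
  rw [Complex.norm_intCast] at h1
  have h2 : (1 : ℝ) ≤ |((n - l : ℤ) : ℝ)| := by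
    exact_mod_cast Int.one_le_abs (sub_ne_zero.2 hne)
  linarith

/-- Two indices whose values are within `1/10` of them cannot share a value, so each coincidence
involves one of the finitely many exceptional indices, and the fibres are finite. -/
lemma finite_setOf_not_isolated {lam : ℤ → ℂ}
    (hlim : Tendsto (fun n : ℤ => lam n - n) cofinite (𝓝 0)) :
    {n | ∃ l, l ≠ n ∧ lam l = lam n}.Finite := by
  let A : Set ℤ := {n | ¬ ‖lam n - n‖ ≤ 1 / 10}
  have hA : A.Finite := eventually_cofinite.1
    ((tendsto_zero_iff_norm_tendsto_zero.1 hlim).eventually_le_const (by norm_num))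
  have hfib : ∀ z, {n | lam n = z}.Finite := by
    intro z
    have hsub : ({n | lam n = z} \ A).Subsingleton := by
      rintro n ⟨hn, hnA⟩ l ⟨hl, hlA⟩
      exact eq_of_norm_sub_le (not_not.1 hnA) (not_not.1 hlA) (Eq.trans hn (Eq.symm hl))
    exact (hA.union hsub.finite).subset fun n hn => by
      by_cases h : n ∈ A
      · exact Or.inl h
      · exact Or.inr ⟨hn, h⟩
  have hB : (⋃ a ∈ A, {n | lam n = lam a}).Finite := hA.biUnion fun a _ => hfib (lam a)
  refine (hA.union hB).subset fun n hn => ?_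
  obtain ⟨l, hln, hl⟩ := hn
  by_cases hnA : n ∈ A
  · exact Or.inl hnA
  refine Or.inr (mem_biUnion (x := l) ?_ hl.symm)
  by_contra hlA
  exact hln (eq_of_norm_sub_le (not_not.1 hlA) (not_not.1 hnA) hl)

end sineType

/-- Every sequence that is `ℓ²`-close to the multiples of `m` is a subsequence of the zeros of a
function of sine type whose perturbation is of exponential type `π / m`. -/
theorem exists_zeros_extending {m : ℕ} (hm : 1 ≤ m) {c : ℂ} (hc : c ≠ 0) {κ : ℤ → ℂ}
    (hκ : Memℓp κ 2) :
    ∃ G ∈ PW, ∃ lam : ℤ → ℂ, Tendsto (fun n : ℤ => lam n - n) cofinite (𝓝 0) ∧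
      (∀ k : ℤ, lam (m * k) = m * k + κ k) ∧
      ∀ z, {n | lam n = z}.encard =
        analyticOrderAt (fun s => c * sin (Real.pi * s) + G (s / m)) z := by
  classical
  have hm0 : (m : ℂ) ≠ 0 := by exact_mod_cast (by omega : m ≠ 0)
  have hmz : (m : ℤ) ≠ 0 := by omega
  have hκ0 := Memℓp.tendsto_zero hκ
  obtain ⟨ρ, hρ, hsin⟩ := exists_norm_sin_bounds
  -- The variable is rescaled by `m`: zeros of `Δ` at `mk + κ k` are zeros of `θ + G` at `ν k`.
  let ν : ℤ → ℂ := fun k => k + κ k / m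
  let θ : ℂ → ℂ := fun x => c * sin (Real.pi * (m * x))
  have hθ : Differentiable ℂ θ := by
    have : Differentiable ℂ fun x : ℂ => sin (Real.pi * (m * x)) := by fun_prop
    exact this.const_mul c
  have hν : Tendsto (fun k : ℤ => ν k - k) cofinite (𝓝 0) := by
    simpa [ν] using hκ0.div_const (m : ℂ)
  have hθν : Memℓp (fun k => θ (ν k)) 2 := by
    refine memℓp_of_eventually_le (C := ‖c‖ * 5) hκ ?_
    filter_upwards [(tendsto_zero_iff_norm_tendsto_zero.1 hκ0).eventually_le_const hρ] with k hk
    have h1 : (m : ℂ) * ν k = ((m * k : ℤ) : ℂ) + κ k := by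
      simp only [ν]; push_cast; field_simp
    simp only [θ]
    rw [h1, norm_mul, norm_sin_int_add, mul_assoc]
    exact mul_le_mul_of_nonneg_left (hsin _ hk).2 (norm_nonneg _)
  obtain ⟨G, hG, hGv⟩ := solvable hθ hν hθν
  refine ⟨G, hG, ?_⟩
  have hW : (fun s => G (s / m)) ∈ PW := by
    have := PW.comp_div hG (m := m) (by exact_mod_cast hm)
    simpa using this
  set W : ℂ → ℂ := fun s => G (s / m) with hWdef
  set Δ : ℂ → ℂ := fun s => c * sin (Real.pi * s) + G (s / m) with hΔdef
  have hΔ1 : IsPolyPW 1 Δ := isPolyPW_sineType hW c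
  have hΔ2 : Δ ∉ PW := sineType_notMem_PW hW hc
  have hΔd := hΔ1.differentiable
  have horder : ∀ z, analyticOrderAt Δ z = analyticOrderAt (θ + G) (z / m) := by
    intro z
    have h1 : Δ = (θ + G) ∘ fun s => s / m := by
      ext s
      simp only [hΔdef, θ, comp_apply, Pi.add_apply]
      rw [mul_div_cancel₀ s hm0]
    rw [h1]
    have hd : HasDerivAt (fun s : ℂ => s / m) (1 / m) z := (hasDerivAt_id z).div_const _
    exact analyticOrderAt_comp_of_deriv_ne_zero (by fun_prop) (by
      rw [hd.deriv]; exact one_div_ne_zero hm0)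
  obtain ⟨ζ, hζ, hζ0⟩ := exists_zeros_near_int hW hc
  -- A provisional numbering: prescribed values at the multiples of `m`, zeros near the integers
  -- elsewhere.
  let lam₀ : ℤ → ℂ := fun n => if (m : ℤ) ∣ n then n + κ (n / m) else n + ζ n
  have hlam₀m : ∀ k : ℤ, lam₀ (m * k) = m * k + κ k := by
    intro k
    simp only [lam₀]
    rw [if_pos (dvd_mul_right _ _), Int.mul_ediv_cancel_left _ hmz]
    push_cast
    ring
  have hlam₀ : Tendsto (fun n : ℤ => lam₀ n - n) cofinite (𝓝 0) := by
    rw [Metric.tendsto_nhds]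
    intro ε hε
    have h1 := Metric.tendsto_nhds.1 hκ0 ε hε
    have h2 := Metric.tendsto_nhds.1 hζ ε hε
    rw [eventually_cofinite] at h1 h2 ⊢
    refine ((h1.image fun k : ℤ => (m : ℤ) * k).union h2).subset fun n hn => ?_
    by_cases hd : (m : ℤ) ∣ n
    · refine Or.inl ⟨n / m, ?_, Int.mul_ediv_cancel' hd⟩
      simp only [mem_ofPred_eq, lam₀, if_pos hd, add_sub_cancel_left] at hn
      exact hn
    · refine Or.inr ?_
      simp only [mem_ofPred_eq, lam₀, if_neg hd, add_sub_cancel_left] at hn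
      exact hn
  have hFfin := (finite_setOf_not_isolated hlam₀).union (eventually_cofinite.1 hζ0)
  -- The indices to be repaired. Multiples of `m` are left out, so the prescribed values survive the
  -- repair even if some of them coincide.
  let F : Finset ℤ := hFfin.toFinset.filter fun n => ¬ (m : ℤ) ∣ n
  have hF : ∀ n, n ∉ F → ¬ (m : ℤ) ∣ n →
      (∀ l, lam₀ l = lam₀ n → l = n) ∧ Δ (lam₀ n) = 0 := by
    intro n hn hd
    simp only [F, Finset.mem_filter, Finite.mem_toFinset, not_and, not_not] at hn
    have hn' := mt hn hd
    simp only [mem_union, mem_ofPred_eq, not_or, not_exists, not_and, not_not] at hn'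
    refine ⟨fun l hl => ?_, ?_⟩
    · by_contra hne
      exact hn'.1 l hne hl
    · simp only [lam₀, if_neg hd]
      exact hn'.2
  have hmF : ∀ k : ℤ, (m : ℤ) * k ∉ F := by
    intro k hk
    exact (Finset.mem_filter.1 hk).2 (dvd_mul_right _ _)
  have hv : VanishesOn Δ lam₀ (F : Set ℤ)ᶜ := by
    intro z
    -- Either `z` is the value of an unrepaired non-multiple of `m`, which then has no companion, or
    -- only multiples of `m` count at `z`, and the multiplicity comes from `hGv`.
    by_cases hex : ∃ n, n ∉ F ∧ ¬ (m : ℤ) ∣ n ∧ lam₀ n = z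
    · obtain ⟨n, hnF, hd, rfl⟩ := hex
      obtain ⟨h1, h2⟩ := hF n hnF hd
      have hsub : {k | k ∈ ((F : Set ℤ)ᶜ) ∧ lam₀ k = lam₀ n} ⊆ {n} := fun l hl => h1 l hl.2
      refine (encard_le_encard hsub).trans ?_
      rw [encard_singleton, Order.one_le_iff_ne_zero, (hΔd.analyticAt _).analyticOrderAt_ne_zero]
      exact h2
    · have hsub : {k | k ∈ ((F : Set ℤ)ᶜ) ∧ lam₀ k = z} ⊆
          (fun k : ℤ => (m : ℤ) * k) '' {k | k ∈ (univ : Set ℤ) ∧ ν k = z / m} := by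
        rintro n ⟨hnF, hnz⟩
        by_cases hd : (m : ℤ) ∣ n
        · obtain ⟨k, rfl⟩ := hd
          refine ⟨k, ⟨mem_univ _, ?_⟩, rfl⟩
          rw [← hnz, hlam₀m]
          simp only [ν]
          field_simp
        · exact absurd ⟨n, hnF, hd, hnz⟩ hex
      refine (encard_le_encard hsub).trans ((encard_image_le _ _).trans ?_)
      rw [horder]
      exact hGv _
  obtain ⟨hcomp, hgen⟩ := isComplete_hasGenerators hlam₀
  obtain ⟨lam, hEq, hlv⟩ := exists_vanishesOn_univ hΔ1 hΔ2 F hcomp hgen hv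
  have hlam : Tendsto (fun n : ℤ => lam n - n) cofinite (𝓝 0) := by
    refine hlam₀.congr' ?_
    have : ∀ᶠ n : ℤ in cofinite, n ∉ F := F.finite_toSet.eventually_cofinite_notMem
    filter_upwards [this] with n hn
    rw [hEq hn]
  refine ⟨lam, hlam, fun k => ?_, ?_⟩
  · rw [← hEq (hmF k), hlam₀m]
  · exact encard_eq_analyticOrderAt hΔ1 hΔ2 (isComplete_hasGenerators hlam).1 hlv

end PaleyWiener

/-! ### Explicit solution of the delay equation -/

namespace DelayDirac

open Complex

lemma ae_uIcc_of_ae_Ioo {P : ℝ → Prop} {b : ℝ} (hb : 0 ≤ b)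
    (h : ∀ᵐ x ∂(volume.restrict (Ioo 0 b)), P x) : ∀ᵐ x, x ∈ uIcc 0 b → P x := by
  rw [uIcc_of_le hb, ← ae_restrict_iff' measurableSet_Icc, ← restrict_Ioo_eq_restrict_Icc]
  exact h

lemma hasDerivAt_cexp_mul (ω : ℂ) (x : ℝ) :
    HasDerivAt (fun t : ℝ => cexp (ω * t)) (ω * cexp (ω * x)) x := by
  have h1 : HasDerivAt (fun s : ℂ => ω * s) ω (x : ℂ) := by
    simpa using! (hasDerivAt_id (x : ℂ)).const_mul ω
  simpa [mul_comm] using! h1.comp_ofReal.cexp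

lemma absolutelyContinuousOnInterval_cexp_mul (ω : ℂ) (a b : ℝ) :
    AbsolutelyContinuousOnInterval (fun t : ℝ => cexp (ω * t)) a b := by
  refine ContDiffOn.absolutelyContinuousOnInterval (ContDiff.contDiffOn ?_)
  have : ContDiff ℝ 1 fun x : ℝ => (x : ℂ) := ofRealCLM.contDiff
  exact (contDiff_const.mul this).cexp

/-- Variation of constants for a scalar linear equation. -/
lemma eq_of_scalar_equation {w h : ℝ → ℂ} {ω : ℂ} {b : ℝ}
    (hw : AbsolutelyContinuousOnInterval w 0 b) (hh : IntervalIntegrable h volume 0 b)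
    (hd : ∀ᵐ x, x ∈ uIcc 0 b → HasDerivAt w (ω * w x - h x) x) {x : ℝ} (hx : x ∈ uIcc 0 b) :
    w x = cexp (ω * x) * (w 0 - ∫ t in 0..x, cexp (-ω * t) * h t) := by
  have hac := (absolutelyContinuousOnInterval_cexp_mul (-ω) 0 b).smul hw
  have hi : IntervalIntegrable (fun t : ℝ => -(cexp (-ω * t) * h t)) volume 0 b :=
    (hh.continuousOn_mul (by fun_prop)).neg
  have h1 := hac.sub_eq_integral hi (by
    filter_upwards [hd] with t ht htb
    refine HasDerivAt.congr_deriv (f := (fun t : ℝ => cexp (-ω * t)) • w)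
      ((hasDerivAt_cexp_mul (-ω) t).mul (ht htb)) ?_
    ring) hx
  rw [intervalIntegral.integral_neg] at h1
  simp only [Pi.smul_apply', smul_eq_mul, ofReal_zero, mul_zero, Complex.exp_zero, one_mul] at h1
  have h2 : w 0 - ∫ t in 0..x, cexp (-ω * t) * h t = cexp (-ω * x) * w x := by
    linear_combination -h1
  rw [h2, ← mul_assoc, ← Complex.exp_add]
  simp

lemma equation_iff (p q : ℝ → ℂ) (x : ℝ) (z : ℂ) (d Y w : Fin 2 → ℂ) :
    B *ᵥ d + Q p q x *ᵥ Y = z • w ↔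
      d 1 + (q x * Y 0 + p x * Y 1) = z * w 0 ∧ -d 0 + (p x * Y 0 - q x * Y 1) = z * w 1 := by
  simp [funext_iff, Fin.forall_fin_two, B, Q, dotProduct, Fin.sum_univ_two,
    sub_eq_add_neg]

section

variable {a : ℝ} {p q : ℝ → ℂ}

lemma IsPotential.intervalIntegrable (h : IsPotential a p q) (c : ℂ) :
    IntervalIntegrable (fun t => p t + c * q t) volume 0 Real.pi := by
  rw [intervalIntegrable_iff_integrableOn_Ioo_of_le Real.pi_pos.le]
  have h1 : MemLp (fun t => p t + c * q t) 2 (volume.restrict (Ioo 0 Real.pi)) :=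
    h.memLp_p.add (h.memLp_q.const_mul c)
  exact h1.integrable (by norm_num)

lemma IsPotential.ae_eq_zero (h : IsPotential a p q) (c : ℂ) :
    ∀ᵐ x, x ∈ Ioo 0 a → p x + c * q x = 0 := by
  rw [← ae_restrict_iff' measurableSet_Ioo]
  filter_upwards [h.p_zero, h.q_zero] with x hp hq
  rw [hp, hq, mul_zero, add_zero]

lemma absolutelyContinuousOnInterval_apply {y : ℝ → Fin 2 → ℂ} {b c : ℝ}
    (hy : AbsolutelyContinuousOnInterval y b c) (i : Fin 2) :
    AbsolutelyContinuousOnInterval (fun x => y x i) b c := by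
  rw [absolutelyContinuousOnInterval_iff] at hy ⊢
  intro ε hε
  obtain ⟨δ, hδ, H⟩ := hy ε hε
  exact ⟨δ, hδ, fun P hP hs => lt_of_le_of_lt
    (Finset.sum_le_sum fun _ _ => dist_le_pi_dist _ _ i) (H P hP hs)⟩

lemma absolutelyContinuousOnInterval_const {E : Type*} [PseudoMetricSpace E] (e : E) (b c : ℝ) :
    AbsolutelyContinuousOnInterval (fun _ => e) b c :=
  (LipschitzWith.const e).lipschitzOnWith.absolutelyContinuousOnInterval

lemma absolutelyContinuousOnInterval_vec {f g : ℝ → ℂ} {b c : ℝ}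
    (hf : AbsolutelyContinuousOnInterval f b c) (hg : AbsolutelyContinuousOnInterval g b c) :
    AbsolutelyContinuousOnInterval (fun x => ![f x, g x]) b c := by
  have h1 := (hf.smul (absolutelyContinuousOnInterval_const (![1, 0] : Fin 2 → ℂ) b c)).add
    (hg.smul (absolutelyContinuousOnInterval_const (![0, 1] : Fin 2 → ℂ) b c))
  refine h1.congr_eqOn fun x _ => ?_
  ext i
  fin_cases i <;> simp

/-- The combinations `y₂ ± i y₁` of the components. -/
def comb (σ : ℂ) (w : Fin 2 → ℂ) : ℂ := w 1 + σ * I * w 0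

/-- The combinations of the components of the solution starting from `(0, 1)`; here `σ = ±1`. -/
def combSol (a : ℝ) (p q : ℝ → ℂ) (σ z : ℂ) (x : ℝ) : ℂ :=
  cexp (-(σ * I * z) * x) *
    (1 - ∫ t in 0..x, (p t + σ * I * q t) * cexp (σ * I * z * (2 * t - a)))

/-- These combinations diagonalise the free system; the potential couples each one only to the
delayed value of the other. -/
lemma hasDerivAt_comb {σ : ℂ} (hσ : σ * σ = 1) {y : ℝ → Fin 2 → ℂ} {z : ℂ} {x : ℝ}
    (hd : DifferentiableAt ℝ y x) (he : B *ᵥ deriv y x + Q p q x *ᵥ y (x - a) = z • y x) :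
    HasDerivAt (fun t => comb σ (y t))
      (-(σ * I * z) * comb σ (y x) - (p x + σ * I * q x) * comb (-σ) (y (x - a))) x := by
  obtain ⟨e1, e2⟩ := (equation_iff p q x z _ _ _).1 he
  have h1 := hasDerivAt_pi.1 hd.hasDerivAt
  refine ((h1 1).add ((h1 0).const_mul (σ * I))).congr_deriv ?_
  unfold comb
  linear_combination e1 - σ * I * e2 +
    (z * y x 0 - q x * y (x - a) 0) * (I * I * (hσ) + I_mul_I) 

lemma comb_eq_of_lt {y : ℝ → Fin 2 → ℂ} {z : ℂ} (ha : 0 ≤ a) (haπ : a ≤ Real.pi)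
    (h : IsPotential a p q) (hy : IsSolution a p q z y) (h0 : y 0 0 = 0) {σ : ℂ} (hσ : σ * σ = 1)
    {x : ℝ} (hx : x ∈ Icc 0 a) : comb σ (y x) = y 0 1 * cexp (-(σ * I * z) * x) := by
  have hac : AbsolutelyContinuousOnInterval (fun t => comb σ (y t)) 0 Real.pi :=
    (absolutelyContinuousOnInterval_apply hy.absCont 1).add
      ((absolutelyContinuousOnInterval_apply hy.absCont 0).const_smul (σ * I))
  have hsub : uIcc 0 a ⊆ uIcc 0 Real.pi := by
    rw [uIcc_of_le ha, uIcc_of_le Real.pi_pos.le]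
    exact Icc_subset_Icc_right haπ
  have h1 := eq_of_scalar_equation (ω := -(σ * I * z)) (h := fun _ => 0) (hac.mono hsub)
    intervalIntegrable_const (by
      refine ae_uIcc_of_ae_Ioo ha ?_
      rw [ae_restrict_iff' measurableSet_Ioo]
      filter_upwards [ae_uIcc_of_ae_Ioo Real.pi_pos.le hy.equation, h.ae_eq_zero (σ * I)]
        with t h1 h2 ht
      have htu : t ∈ uIcc 0 Real.pi := hsub (by
        rw [uIcc_of_le ha]; exact Ioo_subset_Icc_self ht)
      have h3 := hasDerivAt_comb hσ (h1 htu).1 (h1 htu).2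
      rw [h2 ht, zero_mul] at h3
      exact h3) (x := x) (by rwa [uIcc_of_le ha])
  rw [h1]
  simp only [mul_zero, intervalIntegral.integral_zero, sub_zero]
  simp only [comb, h0, mul_zero, add_zero]
  ring

/-- Where `p` and `q` may be nonzero, `0 ≤ x - a ≤ a`, so the delayed term is the free exponential
from `comb_eq_of_lt` and variation of constants closes after one step. -/
lemma comb_eq {y : ℝ → Fin 2 → ℂ} {z : ℂ} (ha : Real.pi ≤ 2 * a) (haπ : a ≤ Real.pi)
    (h : IsPotential a p q) (hy : IsSolution a p q z y) (h0 : y 0 0 = 0) {σ : ℂ} (hσ : σ * σ = 1)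
    {x : ℝ} (hx : x ∈ Icc 0 Real.pi) : comb σ (y x) = y 0 1 * combSol a p q σ z x := by
  have hpi := Real.pi_pos
  have ha0 : 0 ≤ a := by linarith
  have hac : AbsolutelyContinuousOnInterval (fun t => comb σ (y t)) 0 Real.pi :=
    (absolutelyContinuousOnInterval_apply hy.absCont 1).add
      ((absolutelyContinuousOnInterval_apply hy.absCont 0).const_smul (σ * I))
  have hi : IntervalIntegrable (fun t : ℝ => (p t + σ * I * q t) *
      (y 0 1 * cexp (-(-σ * I * z) * (t - a : ℝ)))) volume 0 Real.pi :=
    (h.intervalIntegrable (σ * I)).mul_continuousOn (by fun_prop)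
  have hane : ∀ᵐ x : ℝ, x ≠ a := by simp [ae_iff, measure_singleton]
  have h1 := eq_of_scalar_equation (ω := -(σ * I * z)) hac hi (by
      refine ae_uIcc_of_ae_Ioo hpi.le ?_
      rw [ae_restrict_iff' measurableSet_Ioo]
      filter_upwards [ae_uIcc_of_ae_Ioo hpi.le hy.equation, h.ae_eq_zero (σ * I), hane]
        with t h1 h2 hta ht
      have htu : t ∈ uIcc 0 Real.pi := by
        rw [uIcc_of_le hpi.le]; exact Ioo_subset_Icc_self ht
      have h3 := hasDerivAt_comb hσ (h1 htu).1 (h1 htu).2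
      rcases lt_or_gt_of_ne hta with hlt | hgt
      · rw [h2 ⟨ht.1, hlt⟩, zero_mul] at h3 ⊢
        exact h3
      · rwa [comb_eq_of_lt ha0 haπ h hy h0 (σ := -σ) (by rw [neg_mul_neg, hσ])
          ⟨by linarith, by linarith [ht.2]⟩] at h3) (x := x) (by rwa [uIcc_of_le hpi.le])
  rw [h1, combSol]
  have h2 : ∀ t : ℝ, cexp (-(-(σ * I * z)) * t) * ((p t + σ * I * q t) *
      (y 0 1 * cexp (-(-σ * I * z) * (t - a : ℝ)))) =
      y 0 1 * ((p t + σ * I * q t) * cexp (σ * I * z * (2 * t - a))) := by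
    intro t
    rw [show σ * I * z * (2 * t - a) = -(-(σ * I * z)) * t + -(-σ * I * z) * (t - a : ℝ) by
      push_cast; ring, Complex.exp_add]
    ring
  simp only [h2]
  rw [intervalIntegral.integral_const_mul]
  simp only [comb, h0, mul_zero, add_zero]
  ring

/-- The vector with given combinations `y₂ ± i y₁`. -/
def ofComb (u v : ℂ) : Fin 2 → ℂ := ![(u - v) / (2 * I), (u + v) / 2]

lemma ofComb_comb (w : Fin 2 → ℂ) : ofComb (comb 1 w) (comb (-1) w) = w := by
  ext i
  fin_cases i
  · simp only [ofComb, comb, Fin.zero_eta, Matrix.cons_val_zero]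
    field_simp [I_ne_zero]
    ring
  · simp only [ofComb, comb, Fin.mk_one, Matrix.cons_val_one, Matrix.cons_val_zero]
    ring

lemma hasDerivAt_ofComb {u v : ℝ → ℂ} {u' v' : ℂ} {x : ℝ} (hu : HasDerivAt u u' x)
    (hv : HasDerivAt v v' x) : HasDerivAt (fun t => ofComb (u t) (v t)) (ofComb u' v') x := by
  rw [hasDerivAt_pi]
  intro i
  fin_cases i
  · exact (hu.sub hv).div_const (2 * I)
  · exact (hu.add hv).div_const 2

/-- The solution of the equation starting from `(0, 1)`. -/
def sol (a : ℝ) (p q : ℝ → ℂ) (z : ℂ) (x : ℝ) : Fin 2 → ℂ :=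
  ofComb (combSol a p q 1 z x) (combSol a p q (-1) z x)

lemma sol_zero (z : ℂ) : sol a p q z 0 = ![0, 1] := by
  ext i
  fin_cases i <;> simp [sol, ofComb, combSol]

lemma absolutelyContinuousOnInterval_combSol (h : IsPotential a p q) (σ z : ℂ) :
    AbsolutelyContinuousOnInterval (combSol a p q σ z) 0 Real.pi := by
  have hi : IntervalIntegrable (fun t : ℝ => (p t + σ * I * q t) * cexp (σ * I * z * (2 * t - a)))
      volume 0 Real.pi := (h.intervalIntegrable (σ * I)).mul_continuousOn (by fun_prop)
  exact (absolutelyContinuousOnInterval_cexp_mul (-(σ * I * z)) 0 Real.pi).smul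
    ((absolutelyContinuousOnInterval_const (1 : ℂ) 0 Real.pi).sub
      hi.absolutelyContinuousOnInterval_complex)

lemma combSol_of_le (h : IsPotential a p q) (σ z : ℂ) {x : ℝ} (hx : x ∈ Icc 0 a) :
    combSol a p q σ z x = cexp (-(σ * I * z) * x) := by
  have : ∫ t in 0..x, (p t + σ * I * q t) * cexp (σ * I * z * (2 * t - a)) = 0 := by
    have hane : ∀ᵐ x : ℝ, x ≠ a := by simp [ae_iff, measure_singleton]
    refine intervalIntegral.integral_zero_ae ?_
    filter_upwards [h.ae_eq_zero (σ * I), hane] with t ht hta htx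
    rw [uIoc_of_le hx.1] at htx
    rw [ht ⟨htx.1, lt_of_le_of_ne (htx.2.trans hx.2) hta⟩, zero_mul]
  rw [combSol, this, sub_zero, mul_one]

lemma hasDerivAt_combSol (ha : Real.pi ≤ 2 * a) (h : IsPotential a p q) (σ z : ℂ) :
    ∀ᵐ x ∂(volume.restrict (Ioo 0 Real.pi)), HasDerivAt (combSol a p q σ z)
      (-(σ * I * z) * combSol a p q σ z x -
        (p x + σ * I * q x) * combSol a p q (-σ) z (x - a)) x := by
  have hi : IntervalIntegrable (fun t : ℝ => (p t + σ * I * q t) * cexp (σ * I * z * (2 * t - a)))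
      volume 0 Real.pi := (h.intervalIntegrable (σ * I)).mul_continuousOn (by fun_prop)
  have hane : ∀ᵐ x : ℝ, x ≠ a := by simp [ae_iff, measure_singleton]
  rw [ae_restrict_iff' measurableSet_Ioo]
  filter_upwards [hi.ae_hasDerivAt_integral, h.ae_eq_zero (σ * I), hane] with x h1 h2 hxa hx
  have hxu : x ∈ uIcc 0 Real.pi := by
    rw [uIcc_of_le Real.pi_pos.le]; exact Ioo_subset_Icc_self hx
  have h3 := (hasDerivAt_cexp_mul (-(σ * I * z)) x).mul
    ((h1 hxu 0 left_mem_uIcc).const_sub 1)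
  refine h3.congr_deriv ?_
  have h4 : (p x + σ * I * q x) * combSol a p q (-σ) z (x - a) =
      (p x + σ * I * q x) * (cexp (-(σ * I * z) * x) * cexp (σ * I * z * (2 * x - a))) := by
    rcases lt_or_gt_of_ne hxa with hlt | hgt
    · rw [h2 ⟨hx.1, hlt⟩, zero_mul, zero_mul]
    · rw [combSol_of_le h _ _ ⟨by linarith, by linarith [hx.2]⟩, ← Complex.exp_add]
      congr 2
      push_cast
      ring
  rw [h4, combSol]
  ring

lemma isSolution_sol (ha : Real.pi ≤ 2 * a) (h : IsPotential a p q) (z : ℂ) :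
    IsSolution a p q z (sol a p q z) := by
  have hu := absolutelyContinuousOnInterval_combSol h 1 z
  have hv := absolutelyContinuousOnInterval_combSol h (-1) z
  constructor
  · have h0 := (hu.sub hv).const_smul (2 * I)⁻¹
    have h1 := (hu.add hv).const_smul (2 : ℂ)⁻¹
    refine (absolutelyContinuousOnInterval_vec h0 h1).congr_eqOn fun x _ => ?_
    simp only [sol, ofComb, Pi.sub_apply, Pi.add_apply, smul_eq_mul, div_eq_inv_mul]
  · filter_upwards [hasDerivAt_combSol ha h 1 z, hasDerivAt_combSol ha h (-1) z] with x h1 h2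
    rw [neg_neg] at h2
    have hd : HasDerivAt (sol a p q z) _ x := hasDerivAt_ofComb h1 h2
    refine ⟨hd.differentiableAt, ?_⟩
    rw [hd.deriv, equation_iff]
    set U := combSol a p q 1 z (x - a)
    set V := combSol a p q (-1) z (x - a)
    set u := combSol a p q 1 z x
    set v := combSol a p q (-1) z x
    have e : sol a p q z x = ofComb u v := rfl
    have e' : sol a p q z (x - a) = ofComb U V := rfl
    rw [e, e']
    simp only [ofComb, Matrix.cons_val_zero, Matrix.cons_val_one]
    constructor
    · field_simp [I_ne_zero]
      ring_nf
      simp only [I_sq]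
      ring
    · field_simp [I_ne_zero]
      ring

/-- The characteristic function in terms of the explicit solution. -/
def charFun (a : ℝ) (p q : ℝ → ℂ) (j : Fin 2) (z : ℂ) : ℂ := sol a p q z Real.pi j

/-- Uniqueness for the initial value problem: it identifies every characteristic function with
`charFun` and the eigenvalues with its zeros. -/
lemma eq_smul_sol {y : ℝ → Fin 2 → ℂ} {z : ℂ} (ha : Real.pi ≤ 2 * a) (haπ : a ≤ Real.pi)
    (h : IsPotential a p q) (hy : IsSolution a p q z y) (h0 : y 0 0 = 0) {x : ℝ}
    (hx : x ∈ Icc 0 Real.pi) : y x = y 0 1 • sol a p q z x := by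
  rw [← ofComb_comb (y x), comb_eq ha haπ h hy h0 (by norm_num) hx,
    comb_eq ha haπ h hy h0 (by norm_num) hx, sol]
  ext i
  fin_cases i
  · simp only [ofComb, Fin.zero_eta, Matrix.cons_val_zero, Pi.smul_apply, smul_eq_mul]
    ring
  · simp only [ofComb, Fin.mk_one, Matrix.cons_val_one, Matrix.cons_val_zero, Pi.smul_apply,
      smul_eq_mul]
    ring

lemma isCharFun_charFun (ha : Real.pi ≤ 2 * a) (h : IsPotential a p q) (j : Fin 2) :
    IsCharFun a p q j (charFun a p q j) := fun z =>
  ⟨sol a p q z, isSolution_sol ha h z, sol_zero z, rfl⟩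

lemma IsCharFun.eq_charFun (ha : Real.pi ≤ 2 * a) (haπ : a ≤ Real.pi) (h : IsPotential a p q)
    {j : Fin 2} {Δ : ℂ → ℂ} (hΔ : IsCharFun a p q j Δ) : Δ = charFun a p q j := by
  ext z
  obtain ⟨y, hy, hy0, hΔz⟩ := hΔ z
  rw [hΔz, eq_smul_sol ha haπ h hy (by rw [hy0]; rfl) ⟨Real.pi_pos.le, le_rfl⟩, hy0]
  simp [charFun]

lemma isEigenvalue_iff (ha : Real.pi ≤ 2 * a) (haπ : a ≤ Real.pi) (h : IsPotential a p q)
    {j : Fin 2} {z : ℂ} : IsEigenvalue a p q j z ↔ charFun a p q j z = 0 := by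
  constructor
  · rintro ⟨y, hy, h0, hπ, x, hx, hyx⟩
    rw [eq_smul_sol ha haπ h hy h0 ⟨Real.pi_pos.le, le_rfl⟩] at hπ
    rcases mul_eq_zero.1 hπ with h1 | h1
    · rw [eq_smul_sol ha haπ h hy h0 hx, h1, zero_smul] at hyx
      exact absurd rfl hyx
    · exact h1
  · intro hz
    refine ⟨sol a p q z, isSolution_sol ha h z, by rw [sol_zero]; rfl, hz, 0,
      ⟨le_rfl, Real.pi_pos.le⟩, fun h0 => ?_⟩
    rw [sol_zero] at h0
    simpa using congrFun h0 1

end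

end DelayDirac

/-! ### Characteristic functions as perturbations from the Paley–Wiener space -/

namespace DelayDirac

open Complex PaleyWiener

/-- The delay `π - π / m`. -/
def delay (m : ℕ) : ℝ := Real.pi - Real.pi / m

section delay

variable {m : ℕ} (hm : 2 ≤ m)

include hm

lemma delay_lt : delay m < Real.pi := by
  have : 0 < Real.pi / m := div_pos Real.pi_pos (by exact_mod_cast (by omega : 0 < m))
  unfold delay
  linarith

lemma pi_le_two_mul_delay : Real.pi ≤ 2 * delay m := by
  have : Real.pi / m ≤ Real.pi / 2 :=
    div_le_div_of_nonneg_left Real.pi_pos.le two_pos (by exact_mod_cast hm)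
  unfold delay
  linarith

lemma mul_pi_sub_delay : (m : ℝ) * (Real.pi - delay m) = Real.pi := by
  have : (m : ℝ) ≠ 0 := by exact_mod_cast (by omega : m ≠ 0)
  unfold delay
  field_simp
  ring

/-- Change of variables between `(a, π)` and `(-π, π)`; here `δ = ±1`. -/
lemma integral_comp_delay {δ : ℝ} (hδ : δ = 1 ∨ δ = -1) (F : ℝ → ℂ) :
    ∫ t in (delay m)..Real.pi, F (δ * (m * (2 * t - delay m - Real.pi))) =
      (2 * m : ℂ)⁻¹ * ∫ x in (-Real.pi)..Real.pi, F x := by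
  have hm0 : (m : ℂ) ≠ 0 := by exact_mod_cast (by omega : m ≠ 0)
  have h1 := intervalIntegral.smul_integral_comp_mul_add (a := delay m) (b := Real.pi) F
    (2 * (δ * m)) (-(δ * m) * (delay m + Real.pi))
  have e := mul_pi_sub_delay hm
  have e1 : 2 * (δ * m) * delay m + -(δ * m) * (delay m + Real.pi) = -(δ * Real.pi) := by
    linear_combination -δ * e
  have e2 : 2 * (δ * m) * Real.pi + -(δ * m) * (delay m + Real.pi) = δ * Real.pi := by
    linear_combination δ * e
  rw [e1, e2] at h1
  have h2 : ∀ t : ℝ, δ * (m * (2 * t - delay m - Real.pi)) =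
      2 * (δ * m) * t + -(δ * m) * (delay m + Real.pi) := fun t => by ring
  simp only [h2]
  have h3 : ∫ x in -(δ * Real.pi)..δ * Real.pi, F x = δ * ∫ x in (-Real.pi)..Real.pi, F x := by
    rcases hδ with rfl | rfl
    · simp only [one_mul, ofReal_one]
    · rw [neg_one_mul, neg_neg, intervalIntegral.integral_symm (-Real.pi), ofReal_neg, ofReal_one,
        neg_one_mul]
  have hδ0 : (δ : ℂ) ≠ 0 := by rcases hδ with rfl | rfl <;> norm_num
  rw [real_smul, h3] at h1
  rw [eq_inv_mul_iff_mul_eq₀ (by simpa using hm0)]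
  refine mul_left_cancel₀ hδ0 (Eq.trans ?_ h1)
  rw [ofReal_mul, ofReal_mul, ofReal_ofNat, ofReal_natCast]
  ring

end delay

lemma integral_eq_integral_delay {a : ℝ} {f E : ℝ → ℂ} (ha : 0 ≤ a) (haπ : a ≤ Real.pi)
    (hf : IntervalIntegrable f volume 0 Real.pi) (h0 : ∀ᵐ x, x ∈ Ioo 0 a → f x = 0)
    (hE : Continuous E) :
    ∫ t in 0..Real.pi, f t * E t = ∫ t in a..Real.pi, f t * E t := by
  have hi := hf.mul_continuousOn hE.continuousOn
  have hsub1 : uIcc 0 a ⊆ uIcc 0 Real.pi := by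
    rw [uIcc_of_le ha, uIcc_of_le Real.pi_pos.le]; exact Icc_subset_Icc_right haπ
  have hsub2 : uIcc a Real.pi ⊆ uIcc 0 Real.pi := by
    rw [uIcc_of_le haπ, uIcc_of_le Real.pi_pos.le]; exact Icc_subset_Icc_left ha
  rw [← intervalIntegral.integral_add_adjacent_intervals (hi.mono_set hsub1) (hi.mono_set hsub2)]
  have hane : ∀ᵐ x : ℝ, x ≠ a := by simp [ae_iff, measure_singleton]
  rw [intervalIntegral.integral_zero_ae (by
    filter_upwards [h0, hane] with t ht hta htx
    rw [uIoc_of_le ha] at htx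
    rw [ht ⟨htx.1, lt_of_le_of_ne htx.2 hta⟩, zero_mul]), zero_add]

section transform

variable {m : ℕ} (hm : 2 ≤ m)

include hm

/-- As `t` runs over `(a, π)`, `2t - a - π` runs over `(-π/m, π/m)`; scaling by `m` fills `(-π, π)`
exactly, because `m(π - a) = π`. -/
lemma exists_transform_eq {f : ℝ → ℂ} (hf : MemLp f 2 (volume.restrict (Ioo 0 Real.pi)))
    (h0 : ∀ᵐ x, x ∈ Ioo 0 (delay m) → f x = 0) {δ : ℝ} (hδ : δ = 1 ∨ δ = -1) :
    ∃ G ∈ PW, ∀ z : ℂ, ∫ t in 0..Real.pi, f t * cexp (-(δ * I * z * (2 * t - delay m - Real.pi))) =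
      G (z / m) := by
  have hmR : (0 : ℝ) < m := by exact_mod_cast (by omega : 0 < m)
  have hmC : (m : ℂ) ≠ 0 := by exact_mod_cast hmR.ne'
  have hpi := Real.pi_pos
  have hlt := delay_lt hm
  have hge := pi_le_two_mul_delay hm
  have e := mul_pi_sub_delay hm
  have hδ0 : δ ≠ 0 := by rcases hδ with rfl | rfl <;> norm_num
  have hδ2 : δ * δ = 1 := by rcases hδ with rfl | rfl <;> norm_num
  let κ : ℝ := δ / (2 * m)
  have hκ : κ ≠ 0 := div_ne_zero hδ0 (by positivity)
  have h1 := memLp_comp_affine measurableSet_Ioo hf hκ ((delay m + Real.pi) / 2)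
  have hκπ : |κ * Real.pi| ≤ (Real.pi - delay m) / 2 := by
    have h2 : |δ| = 1 := by rcases hδ with rfl | rfl <;> norm_num
    rw [abs_mul, abs_div, h2, abs_of_pos (by positivity : (0 : ℝ) < 2 * m), abs_of_pos hpi,
      div_mul_eq_mul_div, one_mul, div_le_iff₀ (by positivity)]
    linarith
  have hsub : Ioo (-Real.pi) Real.pi ⊆
      (fun x => κ * x + (delay m + Real.pi) / 2) ⁻¹' Ioo 0 Real.pi := by
    intro x hx
    have h2 : |κ * x| < (Real.pi - delay m) / 2 := by
      refine lt_of_lt_of_le ?_ hκπ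
      rw [abs_mul, abs_mul, abs_of_pos hpi]
      exact mul_lt_mul_of_pos_left (abs_lt.2 hx) (abs_pos.2 hκ)
    rw [abs_lt] at h2
    simp only [mem_preimage, mem_Ioo]
    constructor <;> linarith [h2.1, h2.2]
  have h3 : MemLp (fun x => f (κ * x + (delay m + Real.pi) / 2)) 2
      (volume.restrict (Ioc (-Real.pi) Real.pi)) := by
    rw [← restrict_Ioo_eq_restrict_Ioc]
    exact h1.mono_measure (Measure.restrict_mono hsub le_rfl)
  refine ⟨_, mem_PW_of_memLp (h3.const_mul (2 * m : ℂ)⁻¹), fun z => ?_⟩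
  have hfi : IntervalIntegrable f volume 0 Real.pi := by
    rw [intervalIntegrable_iff_integrableOn_Ioo_of_le hpi.le]
    exact hf.integrable (by norm_num)
  rw [integral_eq_integral_delay (by linarith) hlt.le hfi h0 (by fun_prop)]
  simp only [mul_assoc (2 * m : ℂ)⁻¹]
  rw [intervalIntegral.integral_const_mul, ← integral_comp_delay hm hδ]
  refine intervalIntegral.integral_congr fun t _ => ?_
  have e1 : κ * (δ * (m * (2 * t - delay m - Real.pi))) + (delay m + Real.pi) / 2 = t := by
    simp only [κ]
    field_simp
    linear_combination (2 * t - delay m - Real.pi) * hδ2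
  simp only [e1]
  congr 2
  push_cast
  field_simp

lemma exists_function_of_transform {G : ℂ → ℂ} (hG : G ∈ PW) :
    ∃ f : ℝ → ℂ, MemLp f 2 (volume.restrict (Ioo 0 Real.pi)) ∧
      (∀ x, x ∈ Ioo 0 (delay m) → f x = 0) ∧
      ∀ z : ℂ, ∫ t in 0..Real.pi, f t * cexp (-(((-1 : ℝ) : ℂ) * I * z * (2 * t - delay m - Real.pi))) =
        G (z / m) := by
  obtain ⟨w, hw, hWw⟩ := PW.exists_memLp hG
  have hmR : (0 : ℝ) < m := by exact_mod_cast (by omega : 0 < m)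
  have hmC : (m : ℂ) ≠ 0 := by exact_mod_cast hmR.ne'
  have hpi := Real.pi_pos
  have hlt := delay_lt hm
  have hge := pi_le_two_mul_delay hm
  have e := mul_pi_sub_delay hm
  rw [← restrict_Ioo_eq_restrict_Ioc] at hw
  have h1 := memLp_comp_affine measurableSet_Ioo hw (c := -(2 * m))
    (neg_ne_zero.2 (by positivity))
    (m * (delay m + Real.pi))
  have hsub : Ioo (delay m) Real.pi ⊆
      (fun x => -(2 * m) * x + m * (delay m + Real.pi)) ⁻¹' Ioo (-Real.pi) Real.pi := by
    intro x hx
    simp only [mem_preimage, mem_Ioo]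
    have h2 := mul_lt_mul_of_pos_left hx.1 hmR
    have h3 := mul_lt_mul_of_pos_left hx.2 hmR
    constructor <;> nlinarith
  have h2 := (h1.mono_measure (Measure.restrict_mono hsub le_rfl)).const_mul (2 * m : ℂ)
  let f : ℝ → ℂ := (Ioo (delay m) Real.pi).indicator
    (fun x => (2 * m : ℂ) * w (-(2 * m) * x + m * (delay m + Real.pi)))
  have hf : MemLp f 2 (volume.restrict (Ioo 0 Real.pi)) :=
    ((memLp_indicator_iff_restrict measurableSet_Ioo).2 h2).restrict _
  have h0 : ∀ x, x ∈ Ioo 0 (delay m) → f x = 0 := fun x hx =>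
    indicator_of_notMem (fun h => absurd h.1 (not_lt.2 hx.2.le)) _
  refine ⟨f, hf, h0, fun z => ?_⟩
  have hfi : IntervalIntegrable f volume 0 Real.pi := by
    rw [intervalIntegrable_iff_integrableOn_Ioo_of_le hpi.le]
    exact hf.integrable (by norm_num)
  rw [integral_eq_integral_delay (by linarith) hlt.le hfi (Eventually.of_forall h0) (by fun_prop),
    hWw]
  have h4 := integral_comp_delay hm (δ := -1) (Or.inr rfl)
    (fun x => w x * cexp (-(I * (z / m) * x)))
  rw [eq_inv_mul_iff_mul_eq₀ (by simpa using hmC)] at h4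
  rw [← h4, ← intervalIntegral.integral_const_mul]
  refine intervalIntegral.integral_congr_ae ?_
  have hane : ∀ᵐ x : ℝ, x ≠ Real.pi := by simp [ae_iff, measure_singleton]
  filter_upwards [hane] with t htπ ht
  rw [uIoc_of_le hlt.le] at ht
  have hft : f t = (2 * m : ℂ) * w (-(2 * m) * t + m * (delay m + Real.pi)) :=
    indicator_of_mem (show t ∈ Ioo (delay m) Real.pi from ⟨ht.1, lt_of_le_of_ne ht.2 htπ⟩) _
  rw [hft, show -(2 * m) * t + m * (delay m + Real.pi) =
    -1 * (m * (2 * t - delay m - Real.pi)) by ring, mul_assoc]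
  congr 3
  push_cast
  field_simp

end transform

/-- The characteristic function of the problem with zero potential. -/
def freeCharFun (j : Fin 2) (z : ℂ) : ℂ := ![-sin (Real.pi * z), cos (Real.pi * z)] j

lemma combSol_pi (a : ℝ) (p q : ℝ → ℂ) {σ : ℝ} (z : ℂ) :
    combSol a p q σ z Real.pi = cexp (-(σ * I * z) * Real.pi) -
      ∫ t in 0..Real.pi, (p t + σ * I * q t) *
        cexp (-(((-σ : ℝ) : ℂ) * I * z * (2 * t - a - Real.pi))) := by
  rw [combSol, mul_sub, mul_one, ← intervalIntegral.integral_const_mul]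
  congr 1
  refine intervalIntegral.integral_congr fun t _ => ?_
  rw [mul_left_comm, ← Complex.exp_add]
  congr 2
  push_cast
  ring

lemma ofComb_sub (u v A B : ℂ) (j : Fin 2) :
    ofComb (u - A) (v - B) j = ofComb u v j + ofComb (-A) (-B) j := by
  fin_cases j
  · simp only [ofComb, Fin.zero_eta, Matrix.cons_val_zero]
    ring
  · simp only [ofComb, Fin.mk_one, Matrix.cons_val_one, Matrix.cons_val_zero]
    ring

lemma ofComb_exp (j : Fin 2) (z : ℂ) :
    ofComb (cexp (-(I * z) * Real.pi)) (cexp (-(-1 * I * z) * Real.pi)) j = freeCharFun j z := by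
  have e1 : -(I * z) * Real.pi = -(Real.pi * z) * I := by ring
  have e2 : -(-1 * I * z) * Real.pi = Real.pi * z * I := by ring
  rw [e1, e2]
  fin_cases j
  · simp only [ofComb, freeCharFun, Fin.zero_eta, Matrix.cons_val_zero, Complex.sin]
    field_simp [I_ne_zero]
    linear_combination (cexp (-(Real.pi * z * I)) - cexp (Real.pi * z * I)) * I_sq
  · simp only [ofComb, freeCharFun, Fin.mk_one, Matrix.cons_val_one, Matrix.cons_val_zero,
      Complex.cos]
    ring

lemma charFun_eq (a : ℝ) (p q : ℝ → ℂ) (j : Fin 2) (z : ℂ) :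
    charFun a p q j z = freeCharFun j z +
      ofComb (-∫ t in 0..Real.pi, (p t + I * q t) *
          cexp (-(((-1 : ℝ) : ℂ) * I * z * (2 * t - a - Real.pi))))
        (-∫ t in 0..Real.pi, (p t + -1 * I * q t) *
          cexp (-(((1 : ℝ) : ℂ) * I * z * (2 * t - a - Real.pi)))) j := by
  have h1 := combSol_pi a p q (σ := 1) z
  have h2 := combSol_pi a p q (σ := -1) z
  rw [neg_neg] at h2
  rw [charFun, sol]
  push_cast at h1 h2 ⊢
  simp only [one_mul] at h1 h2 ⊢
  rw [h1, h2, ofComb_sub, ofComb_exp]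

section charFun

variable {m : ℕ} (hm : 2 ≤ m)

include hm

lemma exists_charFun_eq {p q : ℝ → ℂ} (h : IsPotential (delay m) p q) (j : Fin 2) :
    ∃ G ∈ PW, ∀ z, charFun (delay m) p q j z = freeCharFun j z + G (z / m) := by
  have hL : ∀ c : ℂ, MemLp (fun t => p t + c * q t) 2 (volume.restrict (Ioo 0 Real.pi)) :=
    fun c => h.memLp_p.add (h.memLp_q.const_mul c)
  obtain ⟨G, hG, hG'⟩ := exists_transform_eq hm (hL I) (h.ae_eq_zero I) (δ := -1) (Or.inr rfl)
  obtain ⟨K, hK, hK'⟩ := exists_transform_eq hm (hL (-1 * I)) (h.ae_eq_zero (-1 * I)) (δ := 1)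
    (Or.inl rfl)
  have key : ∀ z, charFun (delay m) p q j z =
      freeCharFun j z + ofComb (-G (z / m)) (-K (z / m)) j := fun z => by
    rw [charFun_eq, hG', hK']
  fin_cases j
  · refine ⟨(-(2 * I)⁻¹) • G + (2 * I)⁻¹ • K,
      PW.add_mem (PW.smul_mem _ hG) (PW.smul_mem _ hK), fun z => ?_⟩
    rw [key]
    simp only [ofComb, Fin.zero_eta, Matrix.cons_val_zero, Pi.add_apply, Pi.smul_apply, smul_eq_mul]
    ring
  · refine ⟨(-(2 : ℂ)⁻¹) • G + (-(2 : ℂ)⁻¹) • K,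
      PW.add_mem (PW.smul_mem _ hG) (PW.smul_mem _ hK), fun z => ?_⟩
    rw [key]
    simp only [ofComb, Fin.mk_one, Matrix.cons_val_one, Matrix.cons_val_zero, Pi.add_apply,
      Pi.smul_apply, smul_eq_mul]
    ring

/-- One free function is enough: `p = f/2` and `q = f/(2i)` give `p + iq = f` and `p - iq = 0`. The
factors `-2i` and `-2` undo the passage from the combinations to the component `j`. -/
lemma exists_potential {G : ℂ → ℂ} (hG : G ∈ PW) (j : Fin 2) :
    ∃ p q : ℝ → ℂ, IsPotential (delay m) p q ∧
      ∀ z, charFun (delay m) p q j z = freeCharFun j z + G (z / m) := by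
  have hc : (![-(2 * I), -2] : Fin 2 → ℂ) j ≠ 0 := by fin_cases j <;> simp
  obtain ⟨f, hf, hf0, hfG⟩ := exists_function_of_transform hm
    (PW.smul_mem ((![-(2 * I), -2] : Fin 2 → ℂ) j) hG)
  refine ⟨fun t => 2⁻¹ * f t, fun t => (2 * I)⁻¹ * f t,
    ⟨hf.const_mul _, hf.const_mul _, ?_, ?_⟩, fun z => ?_⟩
  · rw [ae_restrict_iff' measurableSet_Ioo]
    exact Eventually.of_forall fun x hx => by rw [hf0 x hx, mul_zero]
  · rw [ae_restrict_iff' measurableSet_Ioo]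
    exact Eventually.of_forall fun x hx => by rw [hf0 x hx, mul_zero]
  · have h1 : ∀ t, 2⁻¹ * f t + I * ((2 * I)⁻¹ * f t) = f t := fun t => by
      field_simp [I_ne_zero]
      ring
    have h2 : ∀ t, 2⁻¹ * f t + -1 * I * ((2 * I)⁻¹ * f t) = 0 := fun t => by
      field_simp [I_ne_zero]
      ring
    rw [charFun_eq]
    simp only [h1, h2, zero_mul, intervalIntegral.integral_zero]
    rw [hfG]
    congr 1
    fin_cases j
    · simp only [ofComb, Fin.zero_eta, Matrix.cons_val_zero, Pi.smul_apply, smul_eq_mul]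
      field_simp [I_ne_zero]
      ring
    · simp only [ofComb, Fin.mk_one, Matrix.cons_val_one, Matrix.cons_val_zero, Pi.smul_apply,
        smul_eq_mul]
      ring

end charFun

/-! ### Characterisation of the subspectra -/

/-- The shift of the spectrum with respect to the integers. -/
def shift (j : Fin 2) : ℂ := (1 - (((j : ℕ) : ℂ) + 1)) / 2

lemma freeCharFun_add_shift (j : Fin 2) (z : ℂ) :
    freeCharFun j (z + shift j) = (![-1, 1] : Fin 2 → ℂ) j * sin (Real.pi * z) := by
  fin_cases j
  · simp [freeCharFun, shift]
  · simp only [freeCharFun, shift, Fin.mk_one, Matrix.cons_val_one, Matrix.cons_val_zero, one_mul]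
    rw [← Complex.cos_sub_pi_div_two]
    congr 1
    push_cast
    ring

/-- The `m`-th subspectra are exactly the sequences that are `ℓ²`-close to the shifted multiples
of `m`. -/
theorem exists_isSubspectrum_iff {m : ℕ} (hm : 2 ≤ m) (j : Fin 2) (μ : ℤ → ℂ) :
    (∃ p q : ℝ → ℂ, IsPotential (delay m) p q ∧ IsSubspectrum m (delay m) p q j μ) ↔
      ∃ κ : ℤ → ℂ, Memℓp κ 2 ∧ ∀ k : ℤ, μ k = (m : ℂ) * (k : ℂ) + shift j + κ k := by
  have hlt := (delay_lt hm).le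
  have hge := pi_le_two_mul_delay hm
  have hmz : (m : ℤ) ≠ 0 := by omega
  have hc : (![-1, 1] : Fin 2 → ℂ) j ≠ 0 := by fin_cases j <;> simp
  constructor
  · rintro ⟨p, q, h, lam, ⟨_, ⟨Δ, hΔ, hmul⟩, hnum⟩, hμ⟩
    obtain rfl := hΔ.eq_charFun hge hlt h
    obtain ⟨G, hG, hGΔ⟩ := exists_charFun_eq hm h j
    have hW : (fun z => G ((z + shift j) / m)) ∈ PW := by
      have h1 := PW.shift (PW.comp_div hG (m := m) (by exact_mod_cast (by omega : 1 ≤ m))) (shift j)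
      simpa using h1
    have hlim : Tendsto (fun n : ℤ => (lam n - shift j) - n) cofinite (𝓝 0) := by
      refine hnum.congr fun n => ?_
      rw [← shift]
      ring
    have h0 : ∀ n, (![-1, 1] : Fin 2 → ℂ) j * sin (Real.pi * (lam n - shift j)) +
        G ((lam n - shift j + shift j) / m) = 0 := by
      intro n
      rw [← freeCharFun_add_shift, sub_add_cancel, ← hGΔ]
      refine apply_eq_zero_of_analyticOrderAt_ne_zero fun h0 => ?_
      have h1 := hmul (lam n)
      rw [h0, encard_eq_zero] at h1
      exact (h1 ▸ (rfl : n ∈ {k | lam k = lam n}) : n ∈ (∅ : Set ℤ))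
    have hℓ := memℓp_zeros hW hc hlim h0
    refine ⟨fun k => lam (m * k) - shift j - ((m * k : ℤ) : ℂ), ?_, fun k => ?_⟩
    · rw [memℓp_gen_iff (by norm_num)] at hℓ ⊢
      exact hℓ.comp_injective (i := fun k : ℤ => (m : ℤ) * k) (mul_right_injective₀ hmz)
    · rw [hμ]
      push_cast
      ring
  · rintro ⟨κ, hκ, hμ⟩
    obtain ⟨G, hG, lam, hlim, hlam, hmul⟩ :=
      exists_zeros_extending (by omega : 1 ≤ m) hc hκ
    -- `G` was built for the zeros shifted to the integers; translating it by `-shift j / m` shifts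
    -- them back.
    obtain ⟨p, q, h, hpq⟩ := exists_potential hm (PW.shift hG (-(shift j / m))) j
    have hΔ : ∀ z, charFun (delay m) p q j z = ((fun s => (![-1, 1] : Fin 2 → ℂ) j *
        sin (Real.pi * s) + G (s / m)) ∘ fun z => z - shift j) z := by
      intro z
      have h1 := freeCharFun_add_shift j (z - shift j)
      rw [sub_add_cancel] at h1
      rw [hpq, h1, Function.comp_apply, sub_div, sub_eq_add_neg (z / m)]
    have hmul' : ∀ z, {n | lam n + shift j = z}.encard =
        analyticOrderAt (charFun (delay m) p q j) z := by
      intro z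
      rw [show charFun (delay m) p q j = _ from funext hΔ,
        analyticOrderAt_comp_of_deriv_ne_zero (by fun_prop) (by simp), ← hmul]
      congr 1
      ext n
      exact eq_sub_iff_add_eq.symm
    have han : Differentiable ℂ (charFun (delay m) p q j) := by
      rw [show charFun (delay m) p q j = _ from funext hΔ]
      have h1 := PW.differentiable hG
      have h2 : Differentiable ℂ fun s : ℂ => sin (Real.pi * s) := by fun_prop
      exact ((h2.const_mul _).add (h1.comp (by fun_prop))).comp (by fun_prop)
    refine ⟨p, q, h, fun n => lam n + shift j, ⟨fun z => ?_,
      ⟨_, isCharFun_charFun hge h j, hmul'⟩, ?_⟩, fun k => ?_⟩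
    · rw [isEigenvalue_iff hge hlt h, ← (han.analyticAt z).analyticOrderAt_ne_zero, ← hmul' z,
        encard_ne_zero]
      rfl
    · refine hlim.congr fun n => ?_
      rw [← shift]
      ring
    · change μ k = lam (m * k) + shift j
      rw [hμ, hlam]
      ring

end DelayDirac

end

/-- `j : Fin 2` is zero-based: `j = 0, 1` stand for the boundary conditions `y₁(π) = 0`,
`y₂(π) = 0`, respectively. -/
theorem theorem4 (m : ℕ) (hm : 2 ≤ m) (j : Fin 2) (μ : ℤ → ℂ) :
    (∃ p q : ℝ → ℂ, DelayDirac.IsPotential (Real.pi - Real.pi / m) p q ∧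
      DelayDirac.IsSubspectrum m (Real.pi - Real.pi / m) p q j μ) ↔
    ∃ κ : ℤ → ℂ, Memℓp κ 2 ∧
      ∀ k : ℤ, μ k = (m : ℂ) * (k : ℂ) + (1 - (((j : ℕ) : ℂ) + 1)) / 2 + κ k :=
  DelayDirac.exists_isSubspectrum_iff hm j μ
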